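/- **Lemma ($\ell^2$-error bound for the pairwise comparison model).** *Setting.* Let $n\ge 2$ and let $\mathcal G=([n],\mathcal E)$ be a fixed connected undirected graph; by convention all self-loops $(i,i)$ belong to $\mathcal E$. Let $d_{\max}=\max_i |\{j:(i,j)\in\mathcal E\}|$ (the self-loop is counted) and $d=2d_{\max}$. For every ordered pair $(i,j)\in\mathcal E$ with $i\ne j$ let $p_{ij}\in(0,1)$ be the probability that $j$ beats $i$ in an "$i$ vs. $j$" comparison; the $p_{ij}$ are otherwise arbitrary (in particular they need not come from a Bradley–Terry–Luce model, and $p_{ij}+p_{ji}=1$ is not required). The canonical Markov matrix $S\in\mathbb R^{n\times n}$ has entries $S_{ij}=p_{ij}/d$ for $(i,j)\in\mathcal E$, $i\neq j$, $S_{ii}=1-\frac1d\sum_{u\ne i,(i,u)\in\mathcal E}p_{iu}$, and $S_{ij}=0$ otherwise. Let $\pi$ be its stationary distribution, $\Pi=\mathrm{diag}(\pi)$ and $R=\Pi^{1/2}S\Pi^{-1/2}$. For a nonnegative matrix $R$ with entrywise positive left and right eigenvectors $u,v$ for the eigenvalue $1$, $u^{\mathsf T}v=1$, the edge expansion is $$\phi(R)=\min_{\emptyset\ne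 A\subsetneq[n]}\frac{\sum_{i\in A,\,j\in A^c}R_{ij}u_iv_j}{\min\{\sum_{i\in A}u_iv_i,\ \sum_{i\in A^c}u_iv_i\}},$$ and $\phi(R)=0$ if there are no such $u,v$. The principal ratio is $h_\pi=\max_i\pi_i/\min_j\pi_j$. For each $(i,j)\in\mathcal E$ with $i\ne j$ one observes $k$ Bernoulli($p_{ij}$) variables $Z_{m,ij}$, $1\le m\le k$, all of these being mutually independent. The empirical canonical Markov matrix $\hat S$ is obtained from the formula for $S$ by replacing $p_{ij}$ with $\frac1k\sum_{m=1}^kZ_{m,ij}$, and $\hat\pi$ denotes a stationary distribution of $\hat S$ (an arbitrary one if there are several). *Claim.* For all $h,\xi>0$ there are positive constants $c,C,c_2,K$, depending only on $h$ and $\xi$ (not on $n,d_{\max},k$, the graph or the $p_{ij}$), such that the following holds in the above setting for all $n\ge2$. If $$\phi(R)\ge\xi,\qquad h_\pi\le h,\qquad k\ge\max\Big\{1,\frac{c\,h\log n}{d_{\max}\,\xi^4}\Big\},\qquad d_{\max}\ge\log n,$$ then with probability at least $1-K n^{-3}$ every stationary distribution $\hat\pi$ of $\hat S$ satisfies $$\|\pi-\hat\pi\|_2\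 \le\ \frac{C}{\xi^2}\sqrt{\frac{h}{k\,d_{\max}}}\,\sqrt n\,\|\pi\|_\infty\ \le\ \frac{c_2\,\|\pi\|_2}{\sqrt{k\,d_{\max}}},$$ where the second inequality is deterministic. -/

import Mathlib

open scoped Matrix
open MeasureTheory ProbabilityTheory

noncomputable section

namespace PairwiseComparison

variable {n : ℕ}

open Classical in
/-- The adjacency matrix `E` of the observation graph: all self-loops are included. -/
def obsMatrix (G : SimpleGraph (Fin n)) (i j : Fin n) : ℕ :=
  if i = j ∨ G.Adj i j then 1 else 0

/-- The maximum degree `d_max = max_i ∑_j E i j` (self-loops are counted). -/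
def dMax (G : SimpleGraph (Fin n)) : ℕ :=
  Finset.univ.sup fun i => ∑ j, obsMatrix G i j

/-- A pairwise comparison model on the edges of `G`: `p i j` is the probability that `j` beats `i`
in an "`i` vs. `j`" comparison. No relation between `p i j` and `p j i` is required, and values of
`p` off the edges are irrelevant. -/
def IsComparisonModel (G : SimpleGraph (Fin n)) (p : Fin n → Fin n → ℝ) : Prop :=
  ∀ i j, G.Adj i j → 0 < p i j ∧ p i j < 1

open Classical in
/-- The canonical Markov matrix `S` of the comparison probabilities `p`, with `d = 2 * d_max`. -/
def canonicalMarkov (G : SimpleGraph (Fin n)) (p : Fin n → Fin n → ℝ) :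
    Matrix (Fin n) (Fin n) ℝ :=
  Matrix.of fun i j =>
    if i = j then 1 - (∑ u with G.Adj i u, p i u) / (2 * (dMax G : ℝ))
    else if G.Adj i j then p i j / (2 * (dMax G : ℝ))
    else 0

/-- `π` is a stationary (invariant) probability distribution of the Markov matrix `W`. -/
def IsStationary (W : Matrix (Fin n) (Fin n) ℝ) (π : Fin n → ℝ) : Prop :=
  π ∈ stdSimplex ℝ (Fin n) ∧ π ᵥ* W = π

/-- The divergence transition matrix `Π^{1/2} S Π^{-1/2}` with `Π = diag π`. -/
def divergenceTransition (S : Matrix (Fin n) (Fin n) ℝ) (π : Fin n → ℝ) :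
    Matrix (Fin n) (Fin n) ℝ :=
  Matrix.diagonal (fun i => √(π i)) * S * Matrix.diagonal (fun i => (√(π i))⁻¹)

/-- `u` and `v` are entrywise positive left and right eigenvectors of `R` for the eigenvalue `1`,
normalized by `uᵀ v = 1`. -/
def IsPerronPair (R : Matrix (Fin n) (Fin n) ℝ) (u v : Fin n → ℝ) : Prop :=
  (∀ i, 0 < u i) ∧ (∀ i, 0 < v i) ∧ u ᵥ* R = u ∧ R *ᵥ v = v ∧ u ⬝ᵥ v = 1

/-- The quotient of `A` in the definition of the edge expansion. -/
def cutRatio (R : Matrix (Fin n) (Fin n) ℝ) (u v : Fin n → ℝ) (A : Finset (Fin n)) : ℝ :=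
  (∑ i ∈ A, ∑ j ∈ Aᶜ, R i j * u i * v j) / min (∑ i ∈ A, u i * v i) (∑ i ∈ Aᶜ, u i * v i)

/-- The edge expansion `φ(R)` of a nonnegative matrix `R`: the minimum of the cut ratios over the
nonempty proper subsets `A` (for `A = ∅` and `A = [n]` the quotient is `0 / 0`), and `0` if there is
no positive pair of eigenvectors (then the set below is empty, and `sInf ∅ = 0`).
The minimum does not depend on the pair `(u, v)`: if `R` is irreducible, the pair is unique up to
`(t u, t⁻¹ v)`, which changes no cut ratio; if `R` is reducible, a positive pair makes `R` block
diagonal up to a permutation, so the minimum is `0` for every pair. -/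
def edgeExpansion (R : Matrix (Fin n) (Fin n) ℝ) : ℝ :=
  sInf {r : ℝ | ∃ (u v : Fin n → ℝ) (A : Finset (Fin n)),
    IsPerronPair R u v ∧ A.Nonempty ∧ Aᶜ.Nonempty ∧ r = cutRatio R u v A}

/-- The principal ratio `max_i π_i / min_j π_j`. -/
def principalRatio (π : Fin n → ℝ) : ℝ := (⨆ i, π i) / (⨅ j, π j)

/-- The comparison data: for every ordered pair `(i, j)` of adjacent agents there are `k`
outcomes `Z i j m`, each `1` (if `j` beats `i`) with probability `p i j` and `0` otherwise, and all
these outcomes are mutually independent. (`G.Dart` is the type of ordered adjacent pairs.) -/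
structure IsComparisonData {Ω : Type*} [MeasurableSpace Ω] (μ : Measure Ω)
    (G : SimpleGraph (Fin n)) (p : Fin n → Fin n → ℝ) (k : ℕ)
    (Z : Fin n → Fin n → Fin k → Ω → ℝ) : Prop where
  measurable : ∀ i j, G.Adj i j → ∀ m, Measurable (Z i j m)
  zero_or_one : ∀ i j, G.Adj i j → ∀ m ω, Z i j m ω = 0 ∨ Z i j m ω = 1
  prob_one : ∀ i j, G.Adj i j → ∀ m, μ.real {ω | Z i j m ω = 1} = p i j
  indep : iIndepFun (fun (x : G.Dart × Fin k) => Z x.1.fst x.1.snd x.2) μ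

/-- The empirical canonical Markov matrix: `p i j` is replaced by the observed frequency
`Z_{ij} / k`, where `Z_{ij} = ∑ₘ Z i j m`. -/
def empiricalMarkov {Ω : Type*} (G : SimpleGraph (Fin n)) {k : ℕ}
    (Z : Fin n → Fin n → Fin k → Ω → ℝ) (ω : Ω) : Matrix (Fin n) (Fin n) ℝ :=
  canonicalMarkov G fun i j => (∑ m, Z i j m ω) / (k : ℝ)

/-- The Euclidean norm on `ℝⁿ`. -/
def l2Norm (x : Fin n → ℝ) : ℝ := √(∑ i, x i ^ 2)

/-- The maximum norm on `ℝⁿ`. -/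
def linftyNorm (x : Fin n → ℝ) : ℝ := ⨆ i, |x i|

end PairwiseComparison

end

/-! Let r = πŜ − π be the residual and f = (π̂ − π)/π the relative error, and let m and M be the
extreme entries of π. The energy ∑ a_ij (f_i − f_j)² for the empirical flow a_ij = π_i p̂_ij / d
equals 2⟨r, f⟩ + ∑ r_j f_j². The first term uses stationarity of π̂; the second appears because π is
only nearly stationary for Ŝ (`sum_edgeFlow_mul_sq`). If the empirical flow expands, `cheeger`
bounds the energy below by a multiple of ‖f‖², as f has π-mean zero. If r is also small in every
coordinate, the quadratic term is absorbed and ‖π − π̂‖ is at most a constant times ‖r‖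
(`l2Norm_sub_stationary_le`). Neither reversibility nor uniqueness of π̂ enters.

Three events about weighted sums of independent Bernoulli variables remain
(`measureReal_good_event_ge`). (1) Expansion: φ(R) ≥ ξ gives a flow of at least ξ m |A| out of every
small set A (`edgeExpansion_mul_card_le`). A Chernoff bound keeps a quarter of it, failing with
probability at most n^(-4|A|), which is summable over all A. (2) Each coordinate of r has a
sub-Gaussian upper tail. (3) ‖r‖² is at most of order n M² / (k d_max), by averaging the moment
generating function over a Gaussian direction (`measureReal_sum_sq_ge_le`). The principal ratio
converts M / m into powers of h. -/

noncomputable section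

namespace PairwiseComparison

variable {n : ℕ}

/-! ### Cheeger's inequality for edge weights that need not be symmetric. -/

/-- Discrete co-area inequality. -/
theorem mul_sum_le_sum_mul_posPart {ι : Type*} [Fintype ι] [DecidableEq ι] (a : ι → ι → ℝ)
    (φ : ℝ) (F : ι → ℝ) (hF : ∀ i, 0 ≤ F i)
    (hcut : ∀ A : Finset ι, (∀ i ∈ A, 0 < F i) → φ * A.card ≤ ∑ i ∈ A, ∑ j ∈ Aᶜ, a i j) :
    φ * ∑ i, F i ≤ ∑ i, ∑ j, a i j * max (F i - F j) 0 := by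
  -- Peel off the lowest layer: subtracting the least positive value m on the support A shrinks the
  -- support and changes the two sides by φ m |A| and m times the cut of A. Smaller supports inherit
  -- `hcut`.
  induction hN : (Finset.univ.filter fun i => 0 < F i).card using Nat.strong_induction_on
    generalizing F with
  | _ N ih =>
  set A := Finset.univ.filter fun i => 0 < F i with hA
  have hmemA : ∀ i, i ∈ A ↔ 0 < F i := fun i => by simp [hA]
  rcases A.eq_empty_or_nonempty with h0 | hne
  · have hz : ∀ i, F i = 0 := fun i => by
      have : i ∉ A := by simp [h0]
      rw [hmemA] at this
      exact le_antisymm (not_lt.1 this) (hF i)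
    simp [hz]
  obtain ⟨i₀, hi₀, hmin⟩ := A.exists_min_image F hne
  set m := F i₀ with hm
  have hmpos : 0 < m := (hmemA i₀).1 hi₀
  set F' : ι → ℝ := fun i => if i ∈ A then F i - m else F i with hF'
  have hF'0 : ∀ i, 0 ≤ F' i := fun i => by
    by_cases hi : i ∈ A
    · simp [hF', hi, hmin i hi]
    · simp [hF', hi, hF i]
  have hsub : ∀ i, 0 < F' i → 0 < F i := fun i hi => by
    by_cases h : i ∈ A
    · exact (hmemA i).1 h
    · simpa [hF', h] using hi
  have hlt : (Finset.univ.filter fun i => 0 < F' i).card < N := by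
    rw [← hN]
    apply Finset.card_lt_card
    rw [Finset.ssubset_iff_of_subset]
    · exact ⟨i₀, hi₀, by simp [hF', hi₀, ← hm]⟩
    · intro i hi
      rw [hmemA]
      exact hsub i (by simpa using hi)
  have key := ih _ hlt F' hF'0 (fun B hB => hcut B fun i hi => hsub i (hB i hi)) rfl
  have hcA := hcut A fun i hi => (hmemA i).1 hi
  have hnot : ∀ i, i ∉ A → F i = 0 := fun i hi =>
    le_antisymm (not_lt.1 fun h => hi ((hmemA i).2 h)) (hF i)
  have hsum : ∑ i, F i = ∑ i, F' i + m * A.card := by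
    have : ∀ i, F i = F' i + if i ∈ A then m else 0 := fun i => by
      by_cases hi : i ∈ A <;> simp [hF', hi]
    rw [Finset.sum_congr rfl fun i _ => this i, Finset.sum_add_distrib]
    simp [mul_comm]
  -- Only pairs leaving A change: inside A differences are preserved, and from outside into A the
  -- positive part is zero before and after.
  have hterm : ∀ i j, a i j * max (F i - F j) 0 = a i j * max (F' i - F' j) 0 +
      if i ∈ A then (if j ∈ Aᶜ then m * a i j else 0) else 0 := fun i j => by
    by_cases hi : i ∈ A <;> by_cases hj : j ∈ A
    · simp [hF', hi, hj]
    · have h1 := hmin i hi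
      have h2 := hnot j hj
      simp only [hF', hi, hj, h2, Finset.mem_compl, if_true, if_false, not_false_eq_true]
      rw [max_eq_left (by linarith), max_eq_left (by linarith)]
      ring
    · have h1 := hmin j hj
      have h2 := hnot i hi
      simp only [hF', hi, hj, h2, if_true, if_false]
      rw [max_eq_right (by linarith), max_eq_right (by linarith)]
      ring
    · simp [hF', hi, hj]
  simp only [hterm, Finset.sum_add_distrib]
  have hcut' : (∑ i, ∑ j, if i ∈ A then (if j ∈ Aᶜ then m * a i j else 0) else 0) =
      m * ∑ i ∈ A, ∑ j ∈ Aᶜ, a i j := by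
    rw [Finset.mul_sum, ← Finset.sum_filter_add_sum_filter_not Finset.univ (fun i => i ∈ A)]
    rw [Finset.sum_eq_zero (s := Finset.univ.filter fun i => i ∉ A), add_zero,
      Finset.filter_mem_eq_inter, Finset.univ_inter]
    · refine Finset.sum_congr rfl fun i hi => ?_
      simp only [hi, if_true]
      rw [Finset.mul_sum, ← Finset.sum_filter, Finset.filter_mem_eq_inter, Finset.univ_inter]
    · intro i hi
      simp only [Finset.mem_filter] at hi
      simp [hi.2]
  rw [hcut', hsum]
  nlinarith [mul_le_mul_of_nonneg_left hcA hmpos.le]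

/-- Cheeger's inequality for nonnegative functions with small support. -/
theorem cheeger_of_nonneg {ι : Type*} [Fintype ι] [DecidableEq ι] (a : ι → ι → ℝ)
    (ha : ∀ i j, 0 ≤ a i j) (φ D : ℝ) (hφ : 0 ≤ φ) (hD : ∀ i, ∑ j, (a i j + a j i) ≤ D)
    (g : ι → ℝ) (hg : ∀ i, 0 ≤ g i)
    (hcut : ∀ A : Finset ι, (∀ i ∈ A, 0 < g i) → φ * A.card ≤ ∑ i ∈ A, ∑ j ∈ Aᶜ, a i j) :
    φ ^ 2 * ∑ i, g i ^ 2 ≤ 2 * D * ∑ i, ∑ j, a i j * (g i - g j) ^ 2 := by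
  -- Co-area for g², then Cauchy–Schwarz after factoring g_i² − g_j² = (g_i − g_j)(g_i + g_j); one
  -- factor Q cancels at the end.
  have h1 := mul_sum_le_sum_mul_posPart a φ (fun i => g i ^ 2) (fun i => sq_nonneg _)
    (fun A hA => hcut A fun i hi => by
      have := hA i hi
      rcases (hg i).eq_or_lt with h | h
      · simp [← h] at this
      · exact h)
  set T := ∑ i, ∑ j, a i j * (g i - g j) ^ 2 with hT
  set Q := ∑ i, g i ^ 2 with hQ
  have hQ0 : 0 ≤ Q := Finset.sum_nonneg fun i _ => sq_nonneg _
  have h2 : ∑ i, ∑ j, a i j * max (g i ^ 2 - g j ^ 2) 0 ≤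
      ∑ x : ι × ι, (√(a x.1 x.2) * |g x.1 - g x.2|) * (√(a x.1 x.2) * (g x.1 + g x.2)) := by
    rw [Fintype.sum_prod_type]
    refine Finset.sum_le_sum fun i _ => Finset.sum_le_sum fun j _ => ?_
    have e : √(a i j) * |g i - g j| * (√(a i j) * (g i + g j)) =
        a i j * (|g i - g j| * (g i + g j)) := by
      rw [mul_mul_mul_comm, Real.mul_self_sqrt (ha i j)]
    rw [e]
    refine mul_le_mul_of_nonneg_left ?_ (ha i j)
    have hs : 0 ≤ g i + g j := add_nonneg (hg i) (hg j)
    refine max_le ?_ (mul_nonneg (abs_nonneg _) hs)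
    nlinarith [mul_le_mul_of_nonneg_right (le_abs_self (g i - g j)) hs]
  have h3 := Finset.sum_mul_sq_le_sq_mul_sq (Finset.univ : Finset (ι × ι))
    (fun x => √(a x.1 x.2) * |g x.1 - g x.2|) (fun x => √(a x.1 x.2) * (g x.1 + g x.2))
  have h4 : ∑ x : ι × ι, (√(a x.1 x.2) * |g x.1 - g x.2|) ^ 2 = T := by
    rw [Fintype.sum_prod_type]
    simp only [mul_pow, sq_abs, Real.sq_sqrt (ha _ _), hT]
  have h5 : ∑ x : ι × ι, (√(a x.1 x.2) * (g x.1 + g x.2)) ^ 2 ≤ 2 * D * Q := by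
    rw [Fintype.sum_prod_type]
    simp only [mul_pow, Real.sq_sqrt (ha _ _)]
    calc ∑ i, ∑ j, a i j * (g i + g j) ^ 2
        ≤ ∑ i, ∑ j, (2 * (a i j * g i ^ 2) + 2 * (a i j * g j ^ 2)) := by
          refine Finset.sum_le_sum fun i _ => Finset.sum_le_sum fun j _ => ?_
          nlinarith [mul_nonneg (ha i j) (sq_nonneg (g i - g j))]
      _ = ∑ i, (∑ j, (a i j + a j i)) * (2 * g i ^ 2) := by
          simp only [Finset.sum_add_distrib, add_mul]
          congr 1
          · refine Finset.sum_congr rfl fun i _ => ?_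
            rw [Finset.sum_mul]
            exact Finset.sum_congr rfl fun j _ => by ring
          · rw [Finset.sum_comm]
            refine Finset.sum_congr rfl fun i _ => ?_
            rw [Finset.sum_mul]
            exact Finset.sum_congr rfl fun j _ => by ring
      _ ≤ ∑ i, D * (2 * g i ^ 2) :=
          Finset.sum_le_sum fun i _ => mul_le_mul_of_nonneg_right (hD i) (by positivity)
      _ = 2 * D * Q := by
          rw [hQ, Finset.mul_sum]
          exact Finset.sum_congr rfl fun j _ => by ring
  have hT0 : 0 ≤ T := Finset.sum_nonneg fun i _ => Finset.sum_nonneg fun j _ =>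
    mul_nonneg (ha i j) (sq_nonneg _)
  have h6 : (φ * Q) ^ 2 ≤ T * (2 * D * Q) := by
    calc (φ * Q) ^ 2 ≤ _ := pow_le_pow_left₀ (mul_nonneg hφ hQ0) (h1.trans h2) 2
      _ ≤ _ := h3
      _ ≤ _ := by rw [h4]; exact mul_le_mul_of_nonneg_left h5 hT0
  rcases hQ0.eq_or_lt with h | h
  · rw [← h, mul_zero]
    rcases isEmpty_or_nonempty ι with hι | ⟨⟨i⟩⟩
    · simp [hT]
    · have : 0 ≤ D := (Finset.sum_nonneg fun j _ => add_nonneg (ha i j) (ha j i)).trans (hD i)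
      positivity
  · refine le_of_mul_le_mul_right ?_ h
    nlinarith

/-- Every real function on a finite nonempty type has a median. -/
theorem exists_median {ι : Type*} [Fintype ι] [Nonempty ι] (f : ι → ℝ) :
    ∃ c : ℝ, 2 * (Finset.univ.filter fun i => c < f i).card ≤ Fintype.card ι ∧
      2 * (Finset.univ.filter fun i => f i < c).card ≤ Fintype.card ι := by
  classical
  -- The median is the least value exceeded by at most half of the points. More than half exceed the
  -- next lower value, and those are disjoint from the points below the median.
  set B := Finset.univ.filter fun i₀ =>
    2 * (Finset.univ.filter fun i => f i₀ < f i).card ≤ Fintype.card ι with hB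
  have hne : B.Nonempty := by
    obtain ⟨i₁, -, h₁⟩ := (Finset.univ : Finset ι).exists_max_image f Finset.univ_nonempty
    refine ⟨i₁, ?_⟩
    simp only [hB, Finset.mem_filter, Finset.mem_univ, true_and]
    rw [Finset.filter_eq_empty_iff.2 fun i hi => not_lt.2 (h₁ i hi)]
    simp
  obtain ⟨i₀, hi₀, hmin⟩ := B.exists_min_image f hne
  refine ⟨f i₀, by simpa [hB] using hi₀, ?_⟩
  rcases (Finset.univ.filter fun i => f i < f i₀).eq_empty_or_nonempty with h | h
  · simp [h]
  obtain ⟨i₂, hi₂, hmax⟩ := Finset.exists_max_image _ f h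
  have hi₂' : f i₂ < f i₀ := by simpa using hi₂
  have hnot : i₂ ∉ B := fun hb => absurd (hmin i₂ hb) (not_le.2 hi₂')
  have hcard : Fintype.card ι < 2 * (Finset.univ.filter fun i => f i₂ < f i).card := by
    simpa [hB] using hnot
  have hdis : Disjoint (Finset.univ.filter fun i => f i < f i₀)
      (Finset.univ.filter fun i => f i₂ < f i) := by
    rw [Finset.disjoint_left]
    intro i hi hi'
    have h1 := hmax i hi
    simp only [Finset.mem_filter] at hi'
    linarith [hi'.2]
  have := Finset.card_le_univ ((Finset.univ.filter fun i => f i < f i₀) ∪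
    (Finset.univ.filter fun i => f i₂ < f i))
  rw [Finset.card_union_of_disjoint hdis] at this
  omega

/-- Cheeger's inequality: expansion of small sets bounds the Dirichlet form from below. -/
theorem cheeger {ι : Type*} [Fintype ι] [DecidableEq ι] [Nonempty ι] (a : ι → ι → ℝ)
    (ha : ∀ i j, 0 ≤ a i j) (φ D : ℝ) (hφ : 0 ≤ φ) (hD : ∀ i, ∑ j, (a i j + a j i) ≤ D)
    (hcut : ∀ A : Finset ι, 2 * A.card ≤ Fintype.card ι →
      φ * A.card ≤ ∑ i ∈ A, ∑ j ∈ Aᶜ, a i j) (f : ι → ℝ) :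
    ∃ c : ℝ, φ ^ 2 * ∑ i, (f i - c) ^ 2 ≤ 2 * D * ∑ i, ∑ j, a i j * (f i - f j) ^ 2 := by
  obtain ⟨c, h1, h2⟩ := exists_median f
  have hD0 : 0 ≤ D := by
    obtain ⟨i⟩ := ‹Nonempty ι›
    exact (Finset.sum_nonneg fun j _ => add_nonneg (ha i j) (ha j i)).trans (hD i)
  refine ⟨c, ?_⟩
  -- Both parts of f − c are supported on at most half of the points, so only small sets need to
  -- expand.
  have k1 := cheeger_of_nonneg a ha φ D hφ hD (fun i => max (f i - c) 0)
    (fun i => le_max_right _ _) (fun A hA => hcut A (le_trans (Nat.mul_le_mul_left 2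
      (Finset.card_le_card fun i hi => by simpa using hA i hi)) h1))
  have k2 := cheeger_of_nonneg a ha φ D hφ hD (fun i => max (c - f i) 0)
    (fun i => le_max_right _ _) (fun A hA => hcut A (le_trans (Nat.mul_le_mul_left 2
      (Finset.card_le_card fun i hi => by simpa using hA i hi)) h2))
  have e : ∑ i, (f i - c) ^ 2 = ∑ i, max (f i - c) 0 ^ 2 + ∑ i, max (c - f i) 0 ^ 2 := by
    rw [← Finset.sum_add_distrib]
    refine Finset.sum_congr rfl fun i _ => ?_
    rcases le_total (f i) c with h | h
    · rw [max_eq_right (by linarith : f i - c ≤ 0), max_eq_left (by linarith : 0 ≤ c - f i)]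
      ring
    · rw [max_eq_left (by linarith : 0 ≤ f i - c), max_eq_right (by linarith : c - f i ≤ 0)]
      ring
  -- Splitting does not raise the energy: for a pair straddling c, (x + y)² ≥ x² + y² with x, y ≥ 0.
  have t : ∑ i, ∑ j, a i j * (max (f i - c) 0 - max (f j - c) 0) ^ 2 +
      ∑ i, ∑ j, a i j * (max (c - f i) 0 - max (c - f j) 0) ^ 2 ≤
      ∑ i, ∑ j, a i j * (f i - f j) ^ 2 := by
    simp only [← Finset.sum_add_distrib]
    refine Finset.sum_le_sum fun i _ => Finset.sum_le_sum fun j _ => ?_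
    rw [← mul_add]
    refine mul_le_mul_of_nonneg_left ?_ (ha i j)
    rcases le_total (f i) c with h | h <;> rcases le_total (f j) c with h' | h'
    · rw [max_eq_right (by linarith : f i - c ≤ 0), max_eq_left (by linarith : 0 ≤ c - f i),
        max_eq_right (by linarith : f j - c ≤ 0), max_eq_left (by linarith : 0 ≤ c - f j)]
      nlinarith
    · rw [max_eq_right (by linarith : f i - c ≤ 0), max_eq_left (by linarith : 0 ≤ c - f i),
        max_eq_left (by linarith : 0 ≤ f j - c), max_eq_right (by linarith : c - f j ≤ 0)]
      nlinarith [mul_nonneg (sub_nonneg.2 h) (sub_nonneg.2 h')]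
    · rw [max_eq_left (by linarith : 0 ≤ f i - c), max_eq_right (by linarith : c - f i ≤ 0),
        max_eq_right (by linarith : f j - c ≤ 0), max_eq_left (by linarith : 0 ≤ c - f j)]
      nlinarith [mul_nonneg (sub_nonneg.2 h) (sub_nonneg.2 h')]
    · rw [max_eq_left (by linarith : 0 ≤ f i - c), max_eq_right (by linarith : c - f i ≤ 0),
        max_eq_left (by linarith : 0 ≤ f j - c), max_eq_right (by linarith : c - f j ≤ 0)]
      nlinarith
  rw [e, mul_add]
  nlinarith [mul_le_mul_of_nonneg_left t (by positivity : 0 ≤ 2 * D)]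

/-! ### The canonical Markov matrix and its Dirichlet form. -/

open Classical in
/-- The stationary flow along the edges of `G` for the comparison probabilities `q`. -/
def edgeFlow (G : SimpleGraph (Fin n)) (π : Fin n → ℝ) (q : Fin n → Fin n → ℝ) (i j : Fin n) : ℝ :=
  if G.Adj i j then π i * q i j / (2 * (dMax G : ℝ)) else 0

theorem sum_obsMatrix_le_dMax (G : SimpleGraph (Fin n)) (i : Fin n) :
    ∑ j, obsMatrix G i j ≤ dMax G :=
  Finset.le_sup (f := fun i => ∑ j, obsMatrix G i j) (Finset.mem_univ i)

open Classical in
theorem card_adj_le_dMax (G : SimpleGraph (Fin n)) (i : Fin n) :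
    (Finset.univ.filter fun j => G.Adj i j).card ≤ dMax G := by
  refine le_trans ?_ (sum_obsMatrix_le_dMax G i)
  rw [Finset.card_filter]
  refine Finset.sum_le_sum fun j _ => ?_
  unfold obsMatrix
  split_ifs <;> simp_all

theorem dMax_pos (G : SimpleGraph (Fin n)) (i : Fin n) : 0 < dMax G := by
  refine lt_of_lt_of_le ?_ (sum_obsMatrix_le_dMax G i)
  exact Finset.sum_pos' (fun _ _ => Nat.zero_le _) ⟨i, Finset.mem_univ i, by simp [obsMatrix]⟩

-- The matrix acts as the identity plus a difference operator along edges, so its diagonal entries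
-- need no separate treatment later.
open Classical in
theorem sum_canonicalMarkov_mul (G : SimpleGraph (Fin n)) (q : Fin n → Fin n → ℝ)
    (i : Fin n) (g : Fin n → ℝ) :
    ∑ j, canonicalMarkov G q i j * g j =
      g i + ∑ j, if G.Adj i j then q i j / (2 * (dMax G : ℝ)) * (g j - g i) else 0 := by
  have h : ∀ j, canonicalMarkov G q i j * g j =
      (if i = j then (1 - (∑ u with G.Adj i u, q i u) / (2 * (dMax G : ℝ))) * g i else 0) +
      (if G.Adj i j then q i j / (2 * (dMax G : ℝ)) * g j else 0) := fun j => by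
    unfold canonicalMarkov
    simp only [Matrix.of_apply]
    by_cases hij : i = j
    · subst hij; simp
    · simp [hij]
  simp only [h, Finset.sum_add_distrib, Finset.sum_ite_eq, Finset.mem_univ, if_true]
  rw [← Finset.sum_filter, ← Finset.sum_filter]
  simp only [mul_sub, Finset.sum_sub_distrib]
  rw [← Finset.sum_mul, ← Finset.sum_div]
  ring

theorem canonicalMarkov_nonneg (G : SimpleGraph (Fin n)) (q : Fin n → Fin n → ℝ)
    (hq : ∀ i j, G.Adj i j → 0 ≤ q i j ∧ q i j ≤ 1) (i j : Fin n) :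
    0 ≤ canonicalMarkov G q i j := by
  classical
  have hd : (0 : ℝ) < dMax G := by exact_mod_cast dMax_pos G i
  unfold canonicalMarkov
  simp only [Matrix.of_apply]
  split_ifs with h1 h2
  · have h3 : ∑ u with G.Adj i u, q i u ≤ dMax G := by
      calc ∑ u with G.Adj i u, q i u ≤ ∑ u with G.Adj i u, (1 : ℝ) :=
            Finset.sum_le_sum fun u hu => (hq i u (by simpa using hu)).2
        _ = ((Finset.univ.filter fun j => G.Adj i j).card : ℝ) := by simp
        _ ≤ dMax G := by exact_mod_cast card_adj_le_dMax G i
    rw [sub_nonneg, div_le_one (by positivity)]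
    linarith
  · exact div_nonneg (hq i j h2).1 (by positivity)
  · exact le_rfl

/-- Twice the Dirichlet form of a (not necessarily stationary) weight `π`. -/
theorem sum_edgeFlow_mul_sq (G : SimpleGraph (Fin n)) (q : Fin n → Fin n → ℝ)
    (π f : Fin n → ℝ) :
    ∑ i, ∑ j, edgeFlow G π q i j * (f i - f j) ^ 2 =
      2 * (∑ i, π i * f i ^ 2 - ∑ j, ((fun i => π i * f i) ᵥ* canonicalMarkov G q) j * f j) +
        ∑ j, f j ^ 2 * ((π ᵥ* canonicalMarkov G q) j - π j) := by
  classical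
  have e1 : ∑ j, ((fun i => π i * f i) ᵥ* canonicalMarkov G q) j * f j =
      ∑ i, π i * f i * ∑ j, canonicalMarkov G q i j * f j := by
    simp only [Matrix.vecMul, dotProduct, Finset.sum_mul, Finset.mul_sum]
    rw [Finset.sum_comm]
    exact Finset.sum_congr rfl fun i _ => Finset.sum_congr rfl fun j _ => by ring
  have e2 : ∑ j, f j ^ 2 * ((π ᵥ* canonicalMarkov G q) j - π j) =
      ∑ i, π i * (∑ j, canonicalMarkov G q i j * f j ^ 2) - ∑ i, π i * f i ^ 2 := by
    simp only [Matrix.vecMul, dotProduct, mul_sub, Finset.sum_sub_distrib, Finset.mul_sum]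
    congr 1
    · rw [Finset.sum_comm]
      exact Finset.sum_congr rfl fun i _ => Finset.sum_congr rfl fun j _ => by ring
    · exact Finset.sum_congr rfl fun i _ => by ring
  rw [e1, e2, mul_sub, Finset.mul_sum, Finset.mul_sum, ← Finset.sum_sub_distrib,
    ← Finset.sum_sub_distrib, ← Finset.sum_add_distrib]
  refine Finset.sum_congr rfl fun i _ => ?_
  rw [sum_canonicalMarkov_mul, sum_canonicalMarkov_mul G q i fun j => f j ^ 2]
  -- Uses (f_i − f_j)² = (f_j² − f_i²) − 2 f_i (f_j − f_i).
  have e3 : ∑ j, edgeFlow G π q i j * (f i - f j) ^ 2 =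
      π i * (∑ j, if G.Adj i j then q i j / (2 * (dMax G : ℝ)) * (f j ^ 2 - f i ^ 2) else 0) -
      2 * π i * f i * (∑ j, if G.Adj i j then q i j / (2 * (dMax G : ℝ)) * (f j - f i) else 0) := by
    rw [Finset.mul_sum, Finset.mul_sum, ← Finset.sum_sub_distrib]
    refine Finset.sum_congr rfl fun j _ => ?_
    unfold edgeFlow
    split_ifs
    · ring
    · simp
  rw [e3]
  ring

theorem edgeFlow_nonneg (G : SimpleGraph (Fin n)) (q : Fin n → Fin n → ℝ)
    (hq : ∀ i j, G.Adj i j → 0 ≤ q i j ∧ q i j ≤ 1) (π : Fin n → ℝ) (hπ : ∀ i, 0 ≤ π i)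
    (i j : Fin n) : 0 ≤ edgeFlow G π q i j := by
  unfold edgeFlow
  split_ifs with h
  · exact div_nonneg (mul_nonneg (hπ i) (hq i j h).1) (by positivity)
  · exact le_rfl

/-- At most `dMax G` neighbours contribute two flows of at most `M / (2 * dMax G)` each. This
supplies the constant D in `cheeger`. -/
theorem sum_edgeFlow_add_le (G : SimpleGraph (Fin n)) (q : Fin n → Fin n → ℝ)
    (hq : ∀ i j, G.Adj i j → 0 ≤ q i j ∧ q i j ≤ 1) (π : Fin n → ℝ) (hπ : ∀ i, 0 ≤ π i)
    (M : ℝ) (hM : ∀ i, π i ≤ M) (i : Fin n) :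
    ∑ j, (edgeFlow G π q i j + edgeFlow G π q j i) ≤ M := by
  classical
  have hd : (0 : ℝ) < dMax G := by exact_mod_cast dMax_pos G i
  have hM0 : 0 ≤ M := (hπ i).trans (hM i)
  have hb : ∀ a b, G.Adj a b → edgeFlow G π q a b ≤ M / (2 * dMax G) := fun a b h => by
    simp only [edgeFlow, h, if_true]
    gcongr
    have := hq a b h
    calc π a * q a b ≤ M * 1 := mul_le_mul (hM a) this.2 this.1 hM0
      _ = M := mul_one M
  calc ∑ j, (edgeFlow G π q i j + edgeFlow G π q j i)
      ≤ ∑ j, if G.Adj i j then M / dMax G else 0 := by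
        refine Finset.sum_le_sum fun j _ => ?_
        by_cases h : G.Adj i j
        · simp only [h, if_true]
          have := add_le_add (hb i j h) (hb j i h.symm)
          refine this.trans_eq ?_
          field_simp
          norm_num
        · have h' : ¬ G.Adj j i := fun k => h k.symm
          simp [edgeFlow, h, h']
    _ = (Finset.univ.filter fun j => G.Adj i j).card * (M / dMax G) := by
        rw [← Finset.sum_filter]; simp
    _ ≤ dMax G * (M / dMax G) := by
        have : ((Finset.univ.filter fun j => G.Adj i j).card : ℝ) ≤ dMax G := by
          exact_mod_cast card_adj_le_dMax G i
        gcongr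
    _ = M := by field_simp

/-! ### Deterministic perturbation bound. -/

theorem l2Norm_sq (x : Fin n → ℝ) : l2Norm x ^ 2 = ∑ i, x i ^ 2 :=
  Real.sq_sqrt (Finset.sum_nonneg fun _ _ => sq_nonneg _)

theorem l2Norm_nonneg (x : Fin n → ℝ) : 0 ≤ l2Norm x := Real.sqrt_nonneg _

theorem sum_mul_le_l2Norm (x y : Fin n → ℝ) : ∑ i, x i * y i ≤ l2Norm x * l2Norm y :=
  Real.sum_mul_le_sqrt_mul_sqrt _ x y

/-- Perturbation bound for stationary distributions, given the expansion of the perturbed chain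
with respect to the unperturbed distribution. -/
theorem l2Norm_sub_stationary_le (G : SimpleGraph (Fin n)) (q : Fin n → Fin n → ℝ)
    (hq : ∀ i j, G.Adj i j → 0 ≤ q i j ∧ q i j ≤ 1) (π π' : Fin n → ℝ) (m M ψ : ℝ)
    (hm : 0 < m) (hπm : ∀ i, m ≤ π i) (hπM : ∀ i, π i ≤ M) (hψ : 0 < ψ)
    (hπ : ∑ i, π i = 1) (hπ' : IsStationary (canonicalMarkov G q) π')
    (hcut : ∀ A : Finset (Fin n), 2 * A.card ≤ n →
      ψ * A.card ≤ ∑ i ∈ A, ∑ j ∈ Aᶜ, edgeFlow G π q i j)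
    (hr : ∀ j, (π ᵥ* canonicalMarkov G q - π) j ≤ ψ ^ 2 * m / (4 * M ^ 2)) :
    l2Norm (π - π') ≤ 8 * M ^ 3 / (ψ ^ 2 * m) * l2Norm (π ᵥ* canonicalMarkov G q - π) := by
  have hpos : ∀ i, 0 < π i := fun i => hm.trans_le (hπm i)
  have hne : Nonempty (Fin n) := by
    by_contra h
    rw [not_nonempty_iff] at h
    simp at hπ
  have hM : 0 < M := by
    obtain ⟨i⟩ := hne
    exact (hpos i).trans_le (hπM i)
  set r := π ᵥ* canonicalMarkov G q - π with hr_def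
  set f : Fin n → ℝ := fun i => (π' i - π i) / π i with hf
  have hx : (fun i => π i * f i) = π' - π := by
    funext i
    simp only [hf, Pi.sub_apply]
    rw [mul_div_cancel₀ _ (hpos i).ne']
  have hx' : ∀ i, π i * f i = π' i - π i := fun i => congrFun hx i
  obtain ⟨c, hc⟩ := cheeger (edgeFlow G π q) (edgeFlow_nonneg G q hq π fun i => (hpos i).le) ψ M
    hψ.le (sum_edgeFlow_add_le G q hq π (fun i => (hpos i).le) M hπM)
    (fun A hA => hcut A (by simpa using hA)) f
  rw [sum_edgeFlow_mul_sq, hx, Matrix.sub_vecMul, hπ'.2] at hc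
  -- Since π f = π' − π and π' is fixed by the matrix, only the residual survives.
  have e1 : ∑ i, π i * f i ^ 2 - ∑ j, (π' - π ᵥ* canonicalMarkov G q) j * f j =
      ∑ j, r j * f j := by
    rw [← Finset.sum_sub_distrib]
    refine Finset.sum_congr rfl fun j _ => ?_
    have := hx' j
    simp only [hr_def, Pi.sub_apply]
    linear_combination f j * this
  rw [e1] at hc
  set R := l2Norm r
  set F := l2Norm f with hF
  have hF0 : 0 ≤ F := l2Norm_nonneg f
  have hR0 : 0 ≤ R := l2Norm_nonneg r
  have e2 : ∑ j, f j ^ 2 * ((π ᵥ* canonicalMarkov G q) j - π j) ≤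
      ψ ^ 2 * m / (4 * M ^ 2) * F ^ 2 := by
    rw [hF, l2Norm_sq, Finset.mul_sum]
    refine Finset.sum_le_sum fun j _ => ?_
    rw [mul_comm]
    exact mul_le_mul_of_nonneg_right (hr j) (sq_nonneg _)
  have e3 : ∑ j, r j * f j ≤ R * F := sum_mul_le_l2Norm r f
  have hsum0 : ∑ i, π i * f i = 0 := by
    simp only [hx', Finset.sum_sub_distrib, hπ, hπ'.1.2, sub_self]
  -- As f has π-mean zero, shifting by the median c can only increase its π-weighted square norm.
  have e4 : m * F ^ 2 ≤ M * ∑ i, (f i - c) ^ 2 := by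
    calc m * F ^ 2 = ∑ i, m * f i ^ 2 := by rw [hF, l2Norm_sq, Finset.mul_sum]
      _ ≤ ∑ i, π i * f i ^ 2 := Finset.sum_le_sum fun i _ =>
          mul_le_mul_of_nonneg_right (hπm i) (sq_nonneg _)
      _ ≤ ∑ i, π i * f i ^ 2 + c ^ 2 * ∑ i, π i := by
          rw [hπ]; nlinarith [sq_nonneg c]
      _ = ∑ i, π i * (f i - c) ^ 2 + 2 * c * ∑ i, π i * f i := by
          rw [Finset.mul_sum, Finset.mul_sum, ← Finset.sum_add_distrib, ← Finset.sum_add_distrib]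
          exact Finset.sum_congr rfl fun i _ => by ring
      _ = ∑ i, π i * (f i - c) ^ 2 := by rw [hsum0]; ring
      _ ≤ ∑ i, M * (f i - c) ^ 2 := Finset.sum_le_sum fun i _ =>
          mul_le_mul_of_nonneg_right (hπM i) (sq_nonneg _)
      _ = M * ∑ i, (f i - c) ^ 2 := by rw [Finset.mul_sum]
  have e5 : ψ ^ 2 * (m * F ^ 2) ≤
      M * (2 * M * (2 * (R * F) + ψ ^ 2 * m / (4 * M ^ 2) * F ^ 2)) := by
    calc ψ ^ 2 * (m * F ^ 2) ≤ ψ ^ 2 * (M * ∑ i, (f i - c) ^ 2) := by gcongr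
      _ = M * (ψ ^ 2 * ∑ i, (f i - c) ^ 2) := by ring
      _ ≤ _ := by
        refine mul_le_mul_of_nonneg_left (hc.trans ?_) hM.le
        exact mul_le_mul_of_nonneg_left (by linarith) (by positivity)
  -- The threshold in `hr` makes the quadratic correction exactly half of the left side of `e5`, so
  -- it can be absorbed.
  have e6 : M * (2 * M * (2 * (R * F) + ψ ^ 2 * m / (4 * M ^ 2) * F ^ 2)) =
      4 * M ^ 2 * R * F + ψ ^ 2 * m * F ^ 2 / 2 := by
    field_simp
    ring
  rw [e6] at e5
  have e7 : ψ ^ 2 * m * F ≤ 8 * M ^ 2 * R := by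
    rcases hF0.eq_or_lt with h | h
    · rw [← h, mul_zero]; positivity
    · refine le_of_mul_le_mul_right ?_ h
      nlinarith
  have e8 : l2Norm (π - π') ≤ M * F := by
    refine Real.sqrt_le_iff.2 ⟨by positivity, ?_⟩
    rw [mul_pow, hF, l2Norm_sq, Finset.mul_sum]
    refine Finset.sum_le_sum fun i _ => ?_
    rw [show (π - π') i = -(π i * f i) by rw [hx']; simp, neg_sq, mul_pow]
    exact mul_le_mul_of_nonneg_right (pow_le_pow_left₀ (hpos i).le (hπM i) 2) (sq_nonneg _)
  refine e8.trans ?_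
  rw [div_mul_eq_mul_div, le_div_iff₀ (by positivity)]
  nlinarith [mul_le_mul_of_nonneg_left e7 hM.le]

/-! ### From edge expansion to stationary flow. -/

/-- Positive expansion forces a Perron pair to exist, because `sInf ∅ = 0`. If π_i vanished, column
i would be zero (as `0⁻¹ = 0`), and u R = u would give u_i = 0. -/
theorem stationary_pos_of_edgeExpansion_pos (S : Matrix (Fin n) (Fin n) ℝ) (π : Fin n → ℝ)
    (hπ : ∀ i, 0 ≤ π i) (h : 0 < edgeExpansion (divergenceTransition S π)) (i : Fin n) :
    0 < π i := by
  refine (hπ i).lt_of_ne fun h0 => ?_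
  have hne : {r : ℝ | ∃ (u v : Fin n → ℝ) (A : Finset (Fin n)),
      IsPerronPair (divergenceTransition S π) u v ∧ A.Nonempty ∧ Aᶜ.Nonempty ∧
        r = cutRatio (divergenceTransition S π) u v A}.Nonempty := by
    by_contra hc
    rw [Set.not_nonempty_iff_eq_empty] at hc
    rw [edgeExpansion, hc, Real.sInf_empty] at h
    exact lt_irrefl _ h
  obtain ⟨_, u, v, A, ⟨hu, -, hl, -⟩, -⟩ := hne
  have := congrFun hl i
  have hz : ∀ j, divergenceTransition S π j i = 0 := fun j => by
    simp [divergenceTransition, ← h0]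
  simp only [Matrix.vecMul, dotProduct, hz, mul_zero, Finset.sum_const_zero] at this
  exact (hu i).ne this

/-- The edge expansion bounds the stationary flow out of every set. -/
theorem edgeExpansion_mul_le (G : SimpleGraph (Fin n)) (p : Fin n → Fin n → ℝ)
    (hp : ∀ i j, G.Adj i j → 0 ≤ p i j ∧ p i j ≤ 1) (π : Fin n → ℝ)
    (hst : IsStationary (canonicalMarkov G p) π) (hpos : ∀ i, 0 < π i)
    (A : Finset (Fin n)) (hA : A.Nonempty) (hA' : Aᶜ.Nonempty) :
    edgeExpansion (divergenceTransition (canonicalMarkov G p) π) *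
      min (∑ i ∈ A, π i) (∑ i ∈ Aᶜ, π i) ≤ ∑ i ∈ A, ∑ j ∈ Aᶜ, edgeFlow G π p i j := by
  classical
  set S := canonicalMarkov G p with hS
  set R := divergenceTransition S π with hR
  have hRij : ∀ i j, R i j = √(π i) * S i j * (√(π j))⁻¹ := fun i j => by
    simp [hR, divergenceTransition]
  have hs : ∀ i, 0 < √(π i) := fun i => Real.sqrt_pos.2 (hpos i)
  have hss : ∀ i, √(π i) * √(π i) = π i := fun i => Real.mul_self_sqrt (hpos i).le
  have hS0 : ∀ i j, 0 ≤ S i j := canonicalMarkov_nonneg G p hp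
  have hR0 : ∀ i j, 0 ≤ R i j := fun i j => by
    rw [hRij]
    exact mul_nonneg (mul_nonneg (hs i).le (hS0 i j)) (inv_nonneg.2 (hs j).le)
  -- The vector √π is a left eigenvector by stationarity and a right one because rows of S sum to
  -- one.
  have hpair : IsPerronPair R (fun i => √(π i)) (fun i => √(π i)) := by
    refine ⟨hs, hs, ?_, ?_, ?_⟩
    · funext j
      have h1 : ∑ i, π i * S i j = π j := congrFun hst.2 j
      simp only [Matrix.vecMul, dotProduct, hRij]
      calc ∑ i, √(π i) * (√(π i) * S i j * (√(π j))⁻¹) = (∑ i, π i * S i j) * (√(π j))⁻¹ := by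
            rw [Finset.sum_mul]
            refine Finset.sum_congr rfl fun i _ => ?_
            rw [← hss i]
            simp only [hss]
            rw [← mul_assoc, ← mul_assoc, hss]
        _ = √(π j) := by
            rw [h1, mul_inv_eq_iff_eq_mul₀ (hs j).ne', hss]
    · funext i
      have h1 : ∑ j, S i j = 1 := by
        have := sum_canonicalMarkov_mul G p i fun _ => 1
        simpa using this
      simp only [Matrix.mulVec, dotProduct, hRij]
      calc ∑ j, √(π i) * S i j * (√(π j))⁻¹ * √(π j) = √(π i) * ∑ j, S i j := by
            rw [Finset.mul_sum]
            refine Finset.sum_congr rfl fun j _ => ?_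
            rw [inv_mul_cancel_right₀ (hs j).ne']
        _ = √(π i) := by rw [h1, mul_one]
    · simp only [dotProduct, hss]
      exact hst.1.2
  have hle : edgeExpansion R ≤ cutRatio R (fun i => √(π i)) (fun i => √(π i)) A := by
    -- A real `sInf` lies below each member only if the set is bounded below; nonnegativity of R
    -- gives the bound 0.
    refine csInf_le ⟨0, ?_⟩ ⟨_, _, A, hpair, hA, hA', rfl⟩
    rintro _ ⟨u, v, B, hB, -, -, rfl⟩
    refine div_nonneg ?_ (le_min ?_ ?_)
    · exact Finset.sum_nonneg fun i _ => Finset.sum_nonneg fun j _ =>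
        mul_nonneg (mul_nonneg (hR0 i j) (hB.1 i).le) (hB.2.1 j).le
    · exact Finset.sum_nonneg fun i _ => mul_nonneg (hB.1 i).le (hB.2.1 i).le
    · exact Finset.sum_nonneg fun i _ => mul_nonneg (hB.1 i).le (hB.2.1 i).le
  have hmin : 0 < min (∑ i ∈ A, π i) (∑ i ∈ Aᶜ, π i) :=
    lt_min (Finset.sum_pos (fun i _ => hpos i) hA) (Finset.sum_pos (fun i _ => hpos i) hA')
  rw [← le_div_iff₀ hmin]
  refine hle.trans_eq ?_
  unfold cutRatio
  simp only [hss]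
  congr 1
  refine Finset.sum_congr rfl fun i hi => Finset.sum_congr rfl fun j hj => ?_
  have hij : i ≠ j := fun h => by
    subst h
    simp only [Finset.mem_compl] at hj
    exact hj hi
  rw [hRij]
  have : √(π i) * S i j * (√(π j))⁻¹ * √(π i) * √(π j) =
      (√(π i) * √(π i)) * S i j * ((√(π j))⁻¹ * √(π j)) := by ring
  rw [this, hss, inv_mul_cancel₀ (hs j).ne', mul_one]
  simp only [edgeFlow, hS, canonicalMarkov, Matrix.of_apply, hij, if_false]
  split_ifs
  · ring
  · simp

/-! ### Norm of a sub-Gaussian vector by Gaussian averaging. -/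

theorem integral_exp_sq_div_four_gaussianReal :
    ∫ x, Real.exp (x ^ 2 / 4) ∂(gaussianReal 0 1) = √2 := by
  rw [integral_gaussianReal_eq_integral_smul one_ne_zero]
  have h : ∀ x : ℝ, gaussianPDFReal 0 1 x • Real.exp (x ^ 2 / 4) =
      (√(2 * Real.pi))⁻¹ * Real.exp (-(1 / 4) * x ^ 2) := fun x => by
    simp only [gaussianPDFReal, NNReal.coe_one, mul_one, sub_zero, smul_eq_mul]
    rw [mul_assoc, ← Real.exp_add]
    congr 2
    ring
  simp only [h]
  rw [integral_const_mul, integral_gaussian, ← Real.sqrt_inv, ← Real.sqrt_mul (by positivity)]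
  congr 1
  field_simp
  norm_num

/-- A non-integrable function has Bochner integral 0, whereas the computed value is √2. -/
theorem integrable_exp_sq_div_four_gaussianReal :
    Integrable (fun x : ℝ => Real.exp (x ^ 2 / 4)) (gaussianReal 0 1) :=
  Integrable.of_integral_ne_zero (by rw [integral_exp_sq_div_four_gaussianReal]; positivity)

theorem lintegral_ofReal_prod_pi {ι : Type*} [Fintype ι] (ν : Measure ℝ) [SigmaFinite ν]
    (f : ι → ℝ → ℝ) (hf : ∀ i, Integrable (f i) ν) (hf0 : ∀ i x, 0 ≤ f i x) :
    ∫⁻ x : ι → ℝ, ENNReal.ofReal (∏ i, f i (x i)) ∂(Measure.pi fun _ => ν) =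
      ENNReal.ofReal (∏ i, ∫ x, f i x ∂ν) := by
  rw [← integral_fintype_prod_eq_prod, ofReal_integral_eq_lintegral_ofReal]
  · exact Integrable.fintype_prod hf
  · exact ae_of_all _ fun x => Finset.prod_nonneg fun i _ => hf0 i _

/-- Concentration of the Euclidean norm of a sub-Gaussian random vector. -/
theorem measureReal_sum_sq_ge_le {Ω ι : Type*} [MeasurableSpace Ω] [Fintype ι] (μ : Measure Ω)
    [IsProbabilityMeasure μ] (r : Ω → ι → ℝ) (hr : ∀ j, Measurable fun ω => r ω j) (τ : ℝ)
    (hτ : 0 < τ) (hint : ∀ g : ι → ℝ, Integrable (fun ω => Real.exp (∑ j, r ω j * g j)) μ)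
    (hmgf : ∀ g : ι → ℝ, ∫ ω, Real.exp (∑ j, r ω j * g j) ∂μ ≤
      Real.exp (τ / 2 * ∑ j, g j ^ 2)) :
    μ.real {ω | 16 * τ * Fintype.card ι ≤ ∑ j, r ω j ^ 2} ≤ Real.exp (-3 * Fintype.card ι) := by
  set γ := gaussianReal 0 1
  -- With this scale, averaging exp(l⟨r, g⟩) over standard Gaussian g yields exp(‖r‖²/(4τ)), while
  -- `hmgf` bounds the expectation over ω by exp(‖g‖²/4), still Gaussian-integrable.
  set l := √(1 / (2 * τ)) with hl
  have hl2 : l ^ 2 = 1 / (2 * τ) := Real.sq_sqrt (by positivity)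
  set N := Fintype.card ι with hN
  have key : ∫⁻ ω, ENNReal.ofReal (Real.exp (1 / (4 * τ) * ∑ j, r ω j ^ 2)) ∂μ ≤
      ENNReal.ofReal (√2 ^ N) := by
    calc ∫⁻ ω, ENNReal.ofReal (Real.exp (1 / (4 * τ) * ∑ j, r ω j ^ 2)) ∂μ
        = ∫⁻ ω, ∫⁻ g : ι → ℝ, ENNReal.ofReal (Real.exp (∑ j, r ω j * (l * g j)))
            ∂(Measure.pi fun _ => γ) ∂μ := by
          refine lintegral_congr fun ω => ?_
          have e : ∀ g : ι → ℝ, Real.exp (∑ j, r ω j * (l * g j)) =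
              ∏ j, Real.exp (r ω j * l * g j) := fun g => by
            rw [Real.exp_sum]
            exact Finset.prod_congr rfl fun j _ => by rw [mul_assoc]
          simp only [e]
          rw [lintegral_ofReal_prod_pi γ (fun j x => Real.exp (r ω j * l * x))
            (fun j => integrable_exp_mul_gaussianReal _) fun _ _ => (Real.exp_pos _).le]
          congr 1
          rw [Finset.mul_sum, Real.exp_sum]
          refine Finset.prod_congr rfl fun j _ => ?_
          have := congrFun (mgf_fun_id_gaussianReal (μ := 0) (v := 1)) (r ω j * l)
          simp only [mgf] at this
          rw [this]
          congr 1
          simp only [NNReal.coe_one, mul_pow, hl2]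
          field_simp
          ring
      _ = ∫⁻ g : ι → ℝ, ∫⁻ ω, ENNReal.ofReal (Real.exp (∑ j, r ω j * (l * g j))) ∂μ
            ∂(Measure.pi fun _ => γ) := by
          refine lintegral_lintegral_swap ?_
          refine Measurable.aemeasurable ?_
          refine ENNReal.measurable_ofReal.comp (Real.measurable_exp.comp ?_)
          refine Finset.measurable_sum _ fun j _ => ?_
          refine Measurable.mul ((hr j).comp measurable_fst) ?_
          exact measurable_const.mul ((measurable_pi_apply j).comp measurable_snd)
      _ ≤ ∫⁻ g : ι → ℝ, ENNReal.ofReal (∏ j, Real.exp (g j ^ 2 / 4))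
            ∂(Measure.pi fun _ => γ) := by
          refine lintegral_mono fun g => ?_
          rw [← ofReal_integral_eq_lintegral_ofReal (hint fun j => l * g j)
            (ae_of_all _ fun ω => (Real.exp_pos _).le)]
          refine ENNReal.ofReal_le_ofReal ((hmgf fun j => l * g j).trans_eq ?_)
          rw [Finset.mul_sum, Real.exp_sum]
          refine Finset.prod_congr rfl fun j _ => ?_
          rw [mul_pow, hl2]
          congr 1
          field_simp
          ring
      _ = ENNReal.ofReal (√2 ^ N) := by
          rw [lintegral_ofReal_prod_pi γ (fun _ x => Real.exp (x ^ 2 / 4))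
            (fun _ => integrable_exp_sq_div_four_gaussianReal) fun _ _ => (Real.exp_pos _).le]
          simp only [γ, integral_exp_sq_div_four_gaussianReal, Finset.prod_const,
            Finset.card_univ, hN]
  have hmarkov := mul_meas_ge_le_lintegral₀ (μ := μ)
    (f := fun ω => ENNReal.ofReal (Real.exp (1 / (4 * τ) * ∑ j, r ω j ^ 2)))
    (by
      refine Measurable.aemeasurable (ENNReal.measurable_ofReal.comp (Real.measurable_exp.comp ?_))
      exact measurable_const.mul (Finset.measurable_sum _ fun j _ => (hr j).pow_const 2))
    -- The event forces the exponent up to 4N, and the moment √2 ^ N ≤ exp N leaves exp(−3N).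
    (ENNReal.ofReal (Real.exp (4 * N)))
  have hsub : {ω | 16 * τ * N ≤ ∑ j, r ω j ^ 2} ⊆ {ω | ENNReal.ofReal (Real.exp (4 * N)) ≤
      ENNReal.ofReal (Real.exp (1 / (4 * τ) * ∑ j, r ω j ^ 2))} := fun ω hω => by
    simp only [Set.mem_ofPred_eq] at hω ⊢
    refine ENNReal.ofReal_le_ofReal (Real.exp_le_exp.2 ?_)
    rw [one_div, inv_mul_eq_div, le_div_iff₀ (by positivity)]
    linarith
  have h1 : ENNReal.ofReal (Real.exp (4 * N)) * μ {ω | 16 * τ * N ≤ ∑ j, r ω j ^ 2} ≤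
      ENNReal.ofReal (√2 ^ N) :=
    ((mul_le_mul_right (measure_mono hsub) _).trans hmarkov).trans key
  have h2 := ENNReal.toReal_mono ENNReal.ofReal_ne_top h1
  rw [ENNReal.toReal_mul, ENNReal.toReal_ofReal (Real.exp_pos _).le,
    ENNReal.toReal_ofReal (by positivity)] at h2
  have h3 : √2 ^ N ≤ Real.exp N := by
    rw [← Real.exp_one_pow]
    refine pow_le_pow_left₀ (by positivity) ?_ _
    have : √2 ≤ 2 := Real.sqrt_le_iff.2 ⟨by norm_num, by norm_num⟩
    linarith [Real.add_one_le_exp 1]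
  have h4 : Real.exp (-3 * N) = Real.exp N / Real.exp (4 * N) := by
    rw [← Real.exp_sub]; congr 1; ring
  rw [h4, le_div_iff₀ (Real.exp_pos _), mul_comm]
  exact h2.trans h3

/-! ### Tail bounds for weighted Bernoulli sums. -/

section Bernoulli

variable {Ω ι : Type*} [MeasurableSpace Ω] {μ : Measure Ω} [IsProbabilityMeasure μ] [Fintype ι]
  {X : ι → Ω → ℝ} {p : ι → ℝ}

theorem integral_comp_of_zero_or_one {Y : Ω → ℝ} (hY : Measurable Y)
    (h01 : ∀ ω, Y ω = 0 ∨ Y ω = 1) (F : ℝ → ℝ) :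
    ∫ ω, F (Y ω) ∂μ = F 0 + (F 1 - F 0) * μ.real {ω | Y ω = 1} := by
  have hms : MeasurableSet {ω | Y ω = 1} := hY (measurableSet_singleton 1)
  have e : ∀ ω, F (Y ω) = F 0 + {ω | Y ω = 1}.indicator (fun _ => F 1 - F 0) ω := fun ω => by
    rcases h01 ω with h | h
    · simp [h]
    · simp [h]
  simp only [e]
  rw [integral_add (integrable_const _) ((integrable_const _).indicator hms),
    integral_indicator_const _ hms]
  simp [mul_comm]

/-- Weighted centred sums of independent Bernoulli variables are sub-Gaussian. -/
theorem hasSubgaussianMGF_sum (hX : ∀ x, Measurable (X x)) (h01 : ∀ x ω, X x ω = 0 ∨ X x ω = 1)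
    (hp : ∀ x, μ.real {ω | X x ω = 1} = p x) (hind : iIndepFun X μ) (c : ι → ℝ) (τ : NNReal)
    (hτ : ∑ x, c x ^ 2 / 4 ≤ (τ : ℝ)) :
    HasSubgaussianMGF (fun ω => ∑ x, c x * (X x ω - p x)) τ μ := by
  have hi : ∀ x, ∫ ω, X x ω ∂μ = p x := fun x => by
    have := integral_comp_of_zero_or_one (μ := μ) (hX x) (h01 x) id
    simpa [hp x] using this
  have hmem : ∀ x ω, X x ω ∈ Set.Icc (0 : ℝ) 1 := fun x ω => by
    rcases h01 x ω with h | h <;> simp [h]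
  -- Hoeffding's lemma: a variable in [0, 1] has variance proxy 1/4.
  have h1 : ∀ x, HasSubgaussianMGF (fun ω => c x * (X x ω - p x))
      (⟨c x ^ 2, sq_nonneg _⟩ * (‖(1 : ℝ) - 0‖₊ / 2) ^ 2) μ := fun x => by
    have := hasSubgaussianMGF_of_mem_Icc (μ := μ) (hX x).aemeasurable (ae_of_all _ (hmem x))
    rw [hi x] at this
    exact this.const_mul (c x)
  have hind' : iIndepFun (fun x ω => c x * (X x ω - p x)) μ :=
    hind.comp (fun x t => c x * (t - p x)) fun x => by fun_prop
  have h2 := HasSubgaussianMGF.sum_of_iIndepFun hind' (s := Finset.univ) fun x _ => h1 x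
  refine ⟨h2.integrable_exp_mul, fun t => (h2.mgf_le t).trans (Real.exp_le_exp.2 ?_)⟩
  have h3 : ((∑ x, ⟨c x ^ 2, sq_nonneg _⟩ * (‖(1 : ℝ) - 0‖₊ / 2) ^ 2 : NNReal) : ℝ) ≤ τ := by
    refine le_trans (le_of_eq ?_) hτ
    rw [NNReal.coe_sum]
    refine Finset.sum_congr rfl fun x _ => ?_
    change c x ^ 2 * (‖(1 : ℝ) - 0‖ / 2) ^ 2 = _
    rw [sub_zero, norm_one]
    ring
  gcongr

/-- Lower tail bound for weighted sums of independent Bernoulli variables. -/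
theorem measureReal_sum_le_quarter (hX : ∀ x, Measurable (X x))
    (h01 : ∀ x ω, X x ω = 0 ∨ X x ω = 1)
    (hp : ∀ x, μ.real {ω | X x ω = 1} = p x) (hind : iIndepFun X μ) (c : ι → ℝ) (M : ℝ)
    (hM : 0 < M) (hc0 : ∀ x, 0 ≤ c x) (hcM : ∀ x, c x ≤ M) :
    μ.real {ω | ∑ x, c x * X x ω ≤ (∑ x, c x * p x) / 4} ≤
      Real.exp (-(∑ x, c x * p x) / (4 * M)) := by
  have hind' : iIndepFun (fun x ω => c x * X x ω) μ :=
    hind.comp (fun x t => c x * t) fun x => by fun_prop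
  have hmeas : ∀ x, Measurable fun ω => c x * X x ω := fun x => (hX x).const_mul _
  set W := ∑ x, c x * p x with hW
  have hmgf := hind'.mgf_sum (t := -(1 / M)) hmeas Finset.univ
  -- Chernoff at t = −1/M: for s = c/M in [0, 1], exp(−s) ≤ 1 − s/2 bounds each factor by exp(−s
  -- p/2). Their product exp(−W/(2M)) outweighs the Markov factor exp(W/(4M)).
  have hfac : ∀ x, mgf (fun ω => c x * X x ω) μ (-(1 / M)) ≤
      Real.exp (-(c x * p x / (2 * M))) := fun x => by
    have h := integral_comp_of_zero_or_one (μ := μ) (hX x) (h01 x)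
      fun t => Real.exp (-(1 / M) * (c x * t))
    simp only [mgf]
    rw [h, hp x]
    have hp0 : 0 ≤ p x := by rw [← hp x]; exact measureReal_nonneg
    set s := c x / M with hs
    have hs0 : 0 ≤ s := div_nonneg (hc0 x) hM.le
    have hs1 : s ≤ 1 := (div_le_one hM).2 (hcM x)
    have e1 : -(1 / M) * (c x * 1) = -s := by rw [hs]; ring
    have e2 : c x * p x / (2 * M) = s * p x / 2 := by rw [hs]; field_simp
    rw [e1, e2, mul_zero, mul_zero, Real.exp_zero]
    have h5 : Real.exp (-s) ≤ 1 - s / 2 := by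
      rw [Real.exp_neg]
      refine inv_le_of_inv_le₀ (by linarith) ?_
      refine le_trans ?_ (Real.add_one_le_exp s)
      rw [inv_le_iff_one_le_mul₀ (by linarith)]
      nlinarith
    have h6 := Real.add_one_le_exp (-(s * p x / 2))
    nlinarith
  have hint : Integrable (fun ω => Real.exp (-(1 / M) * (∑ x, fun ω => c x * X x ω) ω)) μ := by
    refine Integrable.of_bound (C := 1) ?_ (ae_of_all _ fun ω => ?_)
    · refine Measurable.aestronglyMeasurable (Real.measurable_exp.comp (?_))
      simp only [Finset.sum_apply]
      refine measurable_const.mul ?_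
      exact Finset.measurable_sum _ fun x _ => hmeas x
    · rw [Real.norm_eq_abs, abs_of_pos (Real.exp_pos _), Real.exp_le_one_iff]
      have : 0 ≤ (∑ x, fun ω => c x * X x ω) ω := by
        rw [Finset.sum_apply]
        refine Finset.sum_nonneg fun x _ => mul_nonneg (hc0 x) ?_
        rcases h01 x ω with h | h <;> simp [h]
      have : 0 ≤ 1 / M * (∑ x, fun ω => c x * X x ω) ω := by positivity
      linarith
  have hch := measure_le_le_exp_mul_mgf (μ := μ) (X := ∑ x, fun ω => c x * X x ω) (W / 4)
    (t := -(1 / M)) (by simp [hM.le]) hint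
  simp only [Finset.sum_apply] at hch
  refine hch.trans ?_
  rw [hmgf]
  calc Real.exp (-(-(1 / M)) * (W / 4)) * ∏ x, mgf (fun ω => c x * X x ω) μ (-(1 / M))
      ≤ Real.exp (-(-(1 / M)) * (W / 4)) * ∏ x, Real.exp (-(c x * p x / (2 * M))) := by
        refine mul_le_mul_of_nonneg_left ?_ (Real.exp_pos _).le
        exact Finset.prod_le_prod (fun x _ => mgf_nonneg) fun x _ => hfac x
    _ = Real.exp (-W / (4 * M)) := by
        rw [← Real.exp_sum, ← Real.exp_add, Finset.sum_neg_distrib, ← Finset.sum_div, ← hW]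
        congr 1
        field_simp
        ring

end Bernoulli

/-! ### Residuals and cuts as sums over single outcomes. -/

open Classical in
theorem sum_dart_prod (G : SimpleGraph (Fin n)) (k : ℕ) (F : Fin n → Fin n → Fin k → ℝ) :
    ∑ x : G.Dart × Fin k, F x.1.fst x.1.snd x.2 =
      ∑ i, ∑ j, if G.Adj i j then ∑ m, F i j m else 0 := by
  rw [Fintype.sum_prod_type, ← Fintype.sum_prod_type' fun i j =>
    if G.Adj i j then ∑ m, F i j m else 0, ← Finset.sum_filter]
  refine Finset.sum_bij' (fun (x : G.Dart) _ => (x.fst, x.snd))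
    (fun y hy => ⟨y, by simpa using hy⟩) ?_ ?_ ?_ ?_ ?_
  · intro x _; simp
  · intro y _; simp
  · intro x _; rfl
  · intro y _; rfl
  · intro x _; rfl

theorem sum_vecMul_canonicalMarkov_sub_mul (G : SimpleGraph (Fin n)) (q : Fin n → Fin n → ℝ)
    (π g : Fin n → ℝ) :
    ∑ j, (π ᵥ* canonicalMarkov G q - π) j * g j =
      ∑ i, ∑ j, edgeFlow G π q i j * (g j - g i) := by
  classical
  have e1 : ∑ j, (π ᵥ* canonicalMarkov G q - π) j * g j =
      ∑ i, π i * (∑ j, canonicalMarkov G q i j * g j) - ∑ i, π i * g i := by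
    simp only [Matrix.vecMul, dotProduct, Pi.sub_apply, sub_mul, Finset.sum_sub_distrib,
      Finset.mul_sum, Finset.sum_mul]
    rw [Finset.sum_comm]
    simp only [mul_assoc]
  rw [e1, ← Finset.sum_sub_distrib]
  refine Finset.sum_congr rfl fun i _ => ?_
  rw [sum_canonicalMarkov_mul, mul_add, add_sub_cancel_left, Finset.mul_sum]
  refine Finset.sum_congr rfl fun j _ => ?_
  unfold edgeFlow
  split_ifs
  · ring
  · simp

open Classical in
theorem sum_edgeFlow_mul_eq_sum_dart (G : SimpleGraph (Fin n)) (k : ℕ)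
    (y : Fin n → Fin n → Fin k → ℝ) (π : Fin n → ℝ) (w : Fin n → Fin n → ℝ) :
    ∑ i, ∑ j, edgeFlow G π (fun i j => (∑ m, y i j m) / (k : ℝ)) i j * w i j =
      ∑ x : G.Dart × Fin k, π x.1.fst / (2 * dMax G * k) * w x.1.fst x.1.snd *
        y x.1.fst x.1.snd x.2 := by
  rw [sum_dart_prod G k fun i j m => π i / (2 * dMax G * k) * w i j * y i j m]
  refine Finset.sum_congr rfl fun i _ => Finset.sum_congr rfl fun j _ => ?_
  unfold edgeFlow
  split_ifs
  · rw [← Finset.mul_sum]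
    ring
  · simp

open Classical in
theorem sum_edgeFlow_mul_eq_sum_dart_const (G : SimpleGraph (Fin n)) (k : ℕ) (hk : 0 < k)
    (p : Fin n → Fin n → ℝ) (π : Fin n → ℝ) (w : Fin n → Fin n → ℝ) :
    ∑ i, ∑ j, edgeFlow G π p i j * w i j =
      ∑ x : G.Dart × Fin k, π x.1.fst / (2 * dMax G * k) * w x.1.fst x.1.snd *
        p x.1.fst x.1.snd := by
  have hk' : (k : ℝ) ≠ 0 := by exact_mod_cast hk.ne'
  rw [← sum_edgeFlow_mul_eq_sum_dart G k (fun i j _ => p i j) π w]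
  simp [mul_div_cancel_left₀ _ hk']

/-- Puts a cut in the form of an edge-weighted flow, so the expansion into outcomes applies to it as
well as to the residual. -/
theorem sum_cut_eq (A : Finset (Fin n)) (a : Fin n → Fin n → ℝ) :
    ∑ i ∈ A, ∑ j ∈ Aᶜ, a i j = ∑ i, ∑ j, a i j * if i ∈ A ∧ j ∉ A then 1 else 0 := by
  have : ∀ i, (∑ j, a i j * if i ∈ A ∧ j ∉ A then 1 else 0) =
      if i ∈ A then ∑ j ∈ Aᶜ, a i j else 0 := fun i => by
    by_cases hi : i ∈ A
    · simp only [hi, true_and, if_true, mul_ite, mul_one, mul_zero]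
      rw [← Finset.sum_filter]
      refine Finset.sum_congr ?_ fun _ _ => rfl
      ext j; simp
    · simp [hi]
  simp only [this]
  rw [← Finset.sum_filter, Finset.filter_mem_eq_inter, Finset.univ_inter]

open Classical in
theorem sum_adj_sub_sq_le (G : SimpleGraph (Fin n)) (g : Fin n → ℝ) :
    (∑ i, ∑ j, if G.Adj i j then (g j - g i) ^ 2 else 0) ≤ 4 * dMax G * ∑ i, g i ^ 2 := by
  have h1 : ∀ i : Fin n, (∑ j, if G.Adj i j then 2 * g i ^ 2 else 0) ≤
      dMax G * (2 * g i ^ 2) := fun i => by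
    rw [← Finset.sum_filter, Finset.sum_const, nsmul_eq_mul]
    have : ((Finset.univ.filter fun j => G.Adj i j).card : ℝ) ≤ dMax G := by
      exact_mod_cast card_adj_le_dMax G i
    gcongr
  calc (∑ i, ∑ j, if G.Adj i j then (g j - g i) ^ 2 else 0)
      ≤ ∑ i, ∑ j, ((if G.Adj i j then 2 * g i ^ 2 else 0) +
          if G.Adj i j then 2 * g j ^ 2 else 0) := by
        refine Finset.sum_le_sum fun i _ => Finset.sum_le_sum fun j _ => ?_
        split_ifs
        · nlinarith [sq_nonneg (g i + g j)]
        · simp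
    _ = ∑ i, (∑ j, if G.Adj i j then 2 * g i ^ 2 else 0) +
          ∑ j, ∑ i, if G.Adj j i then 2 * g j ^ 2 else 0 := by
        simp only [Finset.sum_add_distrib]
        congr 1
        rw [Finset.sum_comm]
        simp only [G.adj_comm]
    _ ≤ ∑ i, dMax G * (2 * g i ^ 2) + ∑ i, dMax G * (2 * g i ^ 2) :=
        add_le_add (Finset.sum_le_sum fun i _ => h1 i) (Finset.sum_le_sum fun i _ => h1 i)
    _ = 4 * dMax G * ∑ i, g i ^ 2 := by
        rw [← Finset.mul_sum, ← Finset.mul_sum]; ring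

-- By stationarity of π the same sum with the true p vanishes; subtracting it centres every outcome.
open Classical in
theorem residual_eq_sum_dart {Ω : Type*} {G : SimpleGraph (Fin n)} {p : Fin n → Fin n → ℝ} {k : ℕ}
    {Z : Fin n → Fin n → Fin k → Ω → ℝ} (hk : 0 < k) {π : Fin n → ℝ}
    (hπ : IsStationary (canonicalMarkov G p) π) (g : Fin n → ℝ) (ω : Ω) :
    ∑ j, (π ᵥ* empiricalMarkov G Z ω - π) j * g j =
      ∑ x : G.Dart × Fin k, π x.1.fst / (2 * dMax G * k) * (g x.1.snd - g x.1.fst) *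
        (Z x.1.fst x.1.snd x.2 ω - p x.1.fst x.1.snd) := by
  have h0 : ∑ j, (π ᵥ* canonicalMarkov G p - π) j * g j = 0 := by
    rw [hπ.2]; simp
  rw [sum_vecMul_canonicalMarkov_sub_mul,
    sum_edgeFlow_mul_eq_sum_dart_const G k hk p π fun i j => g j - g i] at h0
  simp only [mul_sub (π _ / _ * _), Finset.sum_sub_distrib]
  rw [empiricalMarkov, sum_vecMul_canonicalMarkov_sub_mul,
    sum_edgeFlow_mul_eq_sum_dart G k (fun i j m => Z i j m ω) π fun i j => g j - g i]
  rw [h0, sub_zero]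

/-! ### Concentration for the comparison data. -/

section Data

variable {Ω : Type*} [MeasurableSpace Ω] {μ : Measure Ω}
  {G : SimpleGraph (Fin n)} {p : Fin n → Fin n → ℝ} {k : ℕ} {Z : Fin n → Fin n → Fin k → Ω → ℝ}

theorem measurable_residual (hZ : IsComparisonData μ G p k Z) (hk : 0 < k)
    {π : Fin n → ℝ} (hπ : IsStationary (canonicalMarkov G p) π) (j : Fin n) :
    Measurable fun ω => (π ᵥ* empiricalMarkov G Z ω - π) j := by
  classical
  have : ∀ ω, (π ᵥ* empiricalMarkov G Z ω - π) j =
      ∑ i, (π ᵥ* empiricalMarkov G Z ω - π) i * (Pi.single j 1 : Fin n → ℝ) i := fun ω => by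
    simp [Pi.single_apply]
  simp only [this, residual_eq_sum_dart hk hπ]
  exact Finset.measurable_sum _ fun x _ =>
    measurable_const.mul ((hZ.measurable _ _ x.1.adj _).sub_const _)

variable [IsProbabilityMeasure μ]

/-- Each edge carries k outcomes of weight at most M/(2 d_max k) times |g_j − g_i|, and the squared
differences over all edges sum to at most 4 d_max ‖g‖². -/
theorem hasSubgaussianMGF_residual (hZ : IsComparisonData μ G p k Z) (hk : 0 < k)
    {π : Fin n → ℝ} (hπ : IsStationary (canonicalMarkov G p) π) (M : ℝ) (hM : ∀ i, π i ≤ M)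
    (hd : 0 < dMax G) (g : Fin n → ℝ) (τ : NNReal)
    (hτ : M ^ 2 / (4 * (k * dMax G)) * ∑ i, g i ^ 2 ≤ τ) :
    HasSubgaussianMGF (fun ω => ∑ j, (π ᵥ* empiricalMarkov G Z ω - π) j * g j) τ μ := by
  classical
  simp only [residual_eq_sum_dart hk hπ]
  have hk' : (0 : ℝ) < k := by exact_mod_cast hk
  have hd' : (0 : ℝ) < dMax G := by exact_mod_cast hd
  refine hasSubgaussianMGF_sum (X := fun (x : G.Dart × Fin k) => Z x.1.fst x.1.snd x.2)
    (p := fun x => p x.1.fst x.1.snd)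
    (fun x => hZ.measurable _ _ x.1.adj _) (fun x => hZ.zero_or_one _ _ x.1.adj _)
    (fun x => hZ.prob_one _ _ x.1.adj _) hZ.indep _ τ (le_trans ?_ hτ)
  rw [sum_dart_prod G k fun i j _ => (π i / (2 * dMax G * k) * (g j - g i)) ^ 2 / 4]
  calc (∑ i, ∑ j, if G.Adj i j then
          ∑ _m : Fin k, (π i / (2 * dMax G * k) * (g j - g i)) ^ 2 / 4 else 0)
      ≤ ∑ i, ∑ j, M ^ 2 / (16 * dMax G ^ 2 * k) *
          if G.Adj i j then (g j - g i) ^ 2 else 0 := by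
        refine Finset.sum_le_sum fun i _ => Finset.sum_le_sum fun j _ => ?_
        split_ifs
        · rw [Finset.sum_const, Finset.card_univ, Fintype.card_fin, nsmul_eq_mul]
          have h1 : π i ^ 2 ≤ M ^ 2 := pow_le_pow_left₀ (hπ.1.1 i) (hM i) 2
          calc (k : ℝ) * ((π i / (2 * dMax G * k) * (g j - g i)) ^ 2 / 4)
              = π i ^ 2 / (16 * dMax G ^ 2 * k) * (g j - g i) ^ 2 := by
                field_simp
                ring
            _ ≤ _ := by gcongr
        · simp
    _ = M ^ 2 / (16 * dMax G ^ 2 * k) * ∑ i, ∑ j, if G.Adj i j then (g j - g i) ^ 2 else 0 := by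
        simp only [Finset.mul_sum]
    _ ≤ M ^ 2 / (16 * dMax G ^ 2 * k) * (4 * dMax G * ∑ i, g i ^ 2) :=
        mul_le_mul_of_nonneg_left (sum_adj_sub_sq_le G g) (by positivity)
    _ = M ^ 2 / (4 * (k * dMax G)) * ∑ i, g i ^ 2 := by
        field_simp
        ring

theorem measureReal_residual_ge_le (hZ : IsComparisonData μ G p k Z) (hk : 0 < k)
    {π : Fin n → ℝ} (hπ : IsStationary (canonicalMarkov G p) π) (M : ℝ) (hM : ∀ i, π i ≤ M)
    (hd : 0 < dMax G) (j : Fin n) (η : ℝ) (hη : 0 ≤ η) :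
    μ.real {ω | η ≤ (π ᵥ* empiricalMarkov G Z ω - π) j} ≤
      Real.exp (-(2 * (k * dMax G) * η ^ 2 / M ^ 2)) := by
  have h := (hasSubgaussianMGF_residual hZ hk hπ M hM hd (Pi.single j 1)
    ⟨M ^ 2 / (4 * (k * dMax G)), by positivity⟩ (by
      change _ ≤ M ^ 2 / (4 * (k * dMax G))
      simp [Pi.single_apply])).measure_ge_le hη
  simp only [Pi.single_apply, mul_ite, mul_one, mul_zero, Finset.sum_ite_eq', Finset.mem_univ,
    if_true] at h
  refine h.trans_eq ?_
  congr 1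
  change -η ^ 2 / (2 * (M ^ 2 / (4 * (k * dMax G)))) = _
  rw [neg_div, neg_inj, mul_div_assoc', div_div_eq_mul_div]
  rcases eq_or_ne M 0 with rfl | hM0
  · simp
  · field_simp
    ring

theorem measureReal_residual_sq_ge_le (hZ : IsComparisonData μ G p k Z) (hk : 0 < k)
    {π : Fin n → ℝ} (hπ : IsStationary (canonicalMarkov G p) π) (M : ℝ) (hM : ∀ i, π i ≤ M)
    (hM0 : 0 < M) (hd : 0 < dMax G) :
    μ.real {ω | 4 * n * M ^ 2 / (k * dMax G) ≤
      ∑ j, (π ᵥ* empiricalMarkov G Z ω - π) j ^ 2} ≤ Real.exp (-3 * n) := by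
  have hk' : (0 : ℝ) < k := by exact_mod_cast hk
  have hd' : (0 : ℝ) < dMax G := by exact_mod_cast hd
  have hs : ∀ g : Fin n → ℝ, 0 ≤ M ^ 2 / (4 * (k * dMax G)) * ∑ i, g i ^ 2 := fun g =>
    mul_nonneg (by positivity) (Finset.sum_nonneg fun _ _ => sq_nonneg _)
  have hsub := fun g => hasSubgaussianMGF_residual hZ hk hπ M hM hd g ⟨_, hs g⟩ le_rfl
  have h := measureReal_sum_sq_ge_le μ (fun ω => π ᵥ* empiricalMarkov G Z ω - π)
    (measurable_residual hZ hk hπ) (M ^ 2 / (4 * (k * dMax G))) (by positivity)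
    (fun g => by simpa using (hsub g).integrable_exp_mul 1)
    (fun g => by
      have := (hsub g).mgf_le 1
      simp only [mgf, one_mul] at this
      refine this.trans_eq ?_
      congr 1
      change M ^ 2 / (4 * (k * dMax G)) * (∑ i, g i ^ 2) * 1 ^ 2 / 2 = _
      ring)
  rw [Fintype.card_fin] at h
  refine le_trans (le_of_eq ?_) h
  congr 1
  ext ω
  simp only [Set.mem_ofPred_eq]
  rw [show 16 * (M ^ 2 / (4 * (k * dMax G))) * n = 4 * n * M ^ 2 / (k * dMax G) by
    field_simp; ring]

/-- The exponent is linear in the cut weight w, hence in |A| when applied; this is what makes the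
union bound over all sets possible. -/
theorem measureReal_cut_le (hZ : IsComparisonData μ G p k Z) (hk : 0 < k)
    {π : Fin n → ℝ} (hπ0 : ∀ i, 0 ≤ π i) (M : ℝ) (hM : ∀ i, π i ≤ M)
    (hM0 : 0 < M) (hd : 0 < dMax G) (A : Finset (Fin n)) (w : ℝ)
    (hw : w ≤ ∑ i ∈ A, ∑ j ∈ Aᶜ, edgeFlow G π p i j) :
    μ.real {ω | ∑ i ∈ A, ∑ j ∈ Aᶜ, edgeFlow G π (fun i j => (∑ m, Z i j m ω) / (k : ℝ)) i j <
      w / 4} ≤ Real.exp (-(w * (k * dMax G) / (2 * M))) := by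
  classical
  have hk' : (0 : ℝ) < k := by exact_mod_cast hk
  have hd' : (0 : ℝ) < dMax G := by exact_mod_cast hd
  have h := measureReal_sum_le_quarter (μ := μ)
    (X := fun (x : G.Dart × Fin k) => Z x.1.fst x.1.snd x.2)
    (p := fun x => p x.1.fst x.1.snd)
    (fun x => hZ.measurable _ _ x.1.adj _) (fun x => hZ.zero_or_one _ _ x.1.adj _)
    (fun x => hZ.prob_one _ _ x.1.adj _) hZ.indep
    (fun x => π x.1.fst / (2 * dMax G * k) * if x.1.fst ∈ A ∧ x.1.snd ∉ A then 1 else 0)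
    (M / (2 * dMax G * k)) (by positivity)
    (fun x => mul_nonneg (div_nonneg (hπ0 _) (by positivity)) (by split_ifs <;> simp))
    (fun x => by
      have h1 : π x.1.fst / (2 * dMax G * k) ≤ M / (2 * dMax G * k) := by
        have := hM x.1.fst
        gcongr
      have h2 : 0 ≤ π x.1.fst / (2 * dMax G * k) := div_nonneg (hπ0 _) (by positivity)
      split_ifs
      · simpa using h1
      · simpa using h2.trans h1)
  rw [← sum_edgeFlow_mul_eq_sum_dart_const G k hk p π
    (fun i j => if i ∈ A ∧ j ∉ A then 1 else 0), ← sum_cut_eq] at h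
  refine le_trans (measureReal_mono fun ω hω => ?_) (h.trans (Real.exp_le_exp.2 ?_))
  · simp only [Set.mem_ofPred_eq] at hω ⊢
    rw [← sum_edgeFlow_mul_eq_sum_dart G k (fun i j m => Z i j m ω) π
      (fun i j => if i ∈ A ∧ j ∉ A then 1 else 0), ← sum_cut_eq]
    linarith
  · rw [neg_div, neg_le_neg_iff]
    calc w * (k * dMax G) / (2 * M) = w / (4 * (M / (2 * dMax G * k))) := by
          field_simp
          norm_num
      _ ≤ _ := by gcongr

end Data

/-! ### Union bound over cuts and coordinates. -/

/-- By the binomial theorem the sum is (1 + t)^N − 1 ≤ exp(N t) − 1, and exp(x) − 1 ≤ 2x on [0, 1].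
-/
theorem sum_pow_card_nonempty_le (ι : Type*) [Fintype ι] [DecidableEq ι] (t : ℝ) (ht : 0 ≤ t)
    (ht1 : Fintype.card ι * t ≤ 1) :
    ∑ A : Finset ι with A.Nonempty, t ^ A.card ≤ 2 * (Fintype.card ι * t) := by
  have h1 : ∑ A : Finset ι, t ^ A.card = (t + 1) ^ Fintype.card ι := by
    have := Finset.sum_pow_mul_eq_add_pow t 1 (Finset.univ : Finset ι)
    simpa using this
  have h2 : ∑ A : Finset ι, t ^ A.card =
      ∑ A : Finset ι with A.Nonempty, t ^ A.card + 1 := by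
    rw [← Finset.sum_filter_add_sum_filter_not Finset.univ (fun A : Finset ι => A.Nonempty)]
    congr 1
    rw [show (Finset.univ.filter fun A : Finset ι => ¬ A.Nonempty) = {∅} by
      ext A; simp [Finset.not_nonempty_iff_eq_empty]]
    simp
  have h3 : (t + 1) ^ Fintype.card ι ≤ Real.exp (Fintype.card ι * t) := by
    rw [Real.exp_nat_mul]
    exact pow_le_pow_left₀ (by linarith) (Real.add_one_le_exp t) _
  have h0 : 0 ≤ Fintype.card ι * t := by positivity
  have h4 := Real.abs_exp_sub_one_le (x := Fintype.card ι * t) (by rwa [abs_of_nonneg h0])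
  rw [abs_of_nonneg h0] at h4
  have h5 := le_abs_self (Real.exp (Fintype.card ι * t) - 1)
  linarith

/-- With high probability the empirical chain expands, its residual is small in every coordinate,
and the Euclidean norm of the residual is of the order of its standard deviation. -/
theorem measureReal_good_event_ge {Ω : Type*} [MeasurableSpace Ω] {μ : Measure Ω}
    [IsProbabilityMeasure μ] {G : SimpleGraph (Fin n)} {p : Fin n → Fin n → ℝ} {k : ℕ}
    {Z : Fin n → Fin n → Fin k → Ω → ℝ} (hn : 2 ≤ n) (hZ : IsComparisonData μ G p k Z)
    (hk : 0 < k) {π : Fin n → ℝ} (hπ : IsStationary (canonicalMarkov G p) π) (M : ℝ)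
    (hM : ∀ i, π i ≤ M) (hM0 : 0 < M) (w η : ℝ) (hη : 0 ≤ η)
    (hcut : ∀ A : Finset (Fin n), A.Nonempty → 2 * A.card ≤ n →
      w * A.card ≤ ∑ i ∈ A, ∑ j ∈ Aᶜ, edgeFlow G π p i j)
    (hw : 4 * Real.log n ≤ w * (k * dMax G) / (2 * M))
    (hη' : 4 * Real.log n ≤ 2 * (k * dMax G) * η ^ 2 / M ^ 2) :
    1 - 4 / (n : ℝ) ^ 3 ≤ μ.real {ω |
      (∀ A : Finset (Fin n), 2 * A.card ≤ n → w / 4 * A.card ≤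
        ∑ i ∈ A, ∑ j ∈ Aᶜ, edgeFlow G π (fun i j => (∑ m, Z i j m ω) / (k : ℝ)) i j) ∧
      (∀ j, (π ᵥ* empiricalMarkov G Z ω - π) j ≤ η) ∧
      ∑ j, (π ᵥ* empiricalMarkov G Z ω - π) j ^ 2 ≤ 4 * n * M ^ 2 / (k * dMax G)} := by
  have hn0 : (0 : ℝ) < n := by positivity
  have hn1 : (1 : ℝ) ≤ n := by exact_mod_cast (by omega : 1 ≤ n)
  have hd : 0 < dMax G := dMax_pos G ⟨0, by omega⟩
  have hexp : Real.exp (-(4 * Real.log n)) = 1 / (n : ℝ) ^ 4 := by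
    rw [Real.exp_neg, one_div, show (4 : ℝ) * Real.log n = ((4 : ℕ) : ℝ) * Real.log n by norm_num,
      Real.exp_nat_mul, Real.exp_log hn0]
  set flow : Ω → Finset (Fin n) → ℝ := fun ω A =>
    ∑ i ∈ A, ∑ j ∈ Aᶜ, edgeFlow G π (fun i j => (∑ m, Z i j m ω) / (k : ℝ)) i j with hflow
  set r : Ω → Fin n → ℝ := fun ω => π ᵥ* empiricalMarkov G Z ω - π with hr
  set good := {ω | (∀ A : Finset (Fin n), 2 * A.card ≤ n → w / 4 * A.card ≤ flow ω A) ∧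
    (∀ j, r ω j ≤ η) ∧ ∑ j, r ω j ^ 2 ≤ 4 * n * M ^ 2 / (k * dMax G)} with hgood
  set 𝒜 := (Finset.univ : Finset (Finset (Fin n))).filter
    fun A => A.Nonempty ∧ 2 * A.card ≤ n with h𝒜
  set B₁ := ⋃ A ∈ 𝒜, {ω | flow ω A < w * A.card / 4} with hB₁
  set B₂ := ⋃ j ∈ (Finset.univ : Finset (Fin n)), {ω | η ≤ r ω j} with hB₂
  set B₃ := {ω | 4 * n * M ^ 2 / (k * dMax G) ≤ ∑ j, r ω j ^ 2} with hB₃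
  -- Covering the whole space and using subadditivity avoids any measurability of the good event.
  have hcover : Set.univ ⊆ good ∪ (B₁ ∪ (B₂ ∪ B₃)) := by
    intro ω _
    by_contra hω
    simp only [Set.mem_union, not_or] at hω
    obtain ⟨hg, h1, h2, h3⟩ := hω
    refine hg ⟨fun A hA => ?_, fun j => ?_, ?_⟩
    · rcases A.eq_empty_or_nonempty with rfl | hne
      · simp [hflow]
      · by_contra hlt
        refine h1 (Set.mem_biUnion (x := A) (by simp [h𝒜, hne, hA]) ?_)
        simp only [Set.mem_ofPred_eq]
        linarith
    · by_contra hlt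
      exact h2 (Set.mem_biUnion (x := j) (by simp) (le_of_lt (not_le.1 hlt)))
    · by_contra hlt
      exact h3 (le_of_lt (not_le.1 hlt))
  have hP₁ : μ.real B₁ ≤ 2 / (n : ℝ) ^ 3 := by
    have ht : (Fintype.card (Fin n) : ℝ) * (1 / (n : ℝ) ^ 4) = 1 / (n : ℝ) ^ 3 := by
      rw [Fintype.card_fin]; field_simp
    calc μ.real B₁ ≤ ∑ A ∈ 𝒜, μ.real {ω | flow ω A < w * A.card / 4} :=
          measureReal_biUnion_finset_le _ _
      _ ≤ ∑ A ∈ 𝒜, (1 / (n : ℝ) ^ 4) ^ A.card := by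
          refine Finset.sum_le_sum fun A hA => ?_
          simp only [h𝒜, Finset.mem_filter] at hA
          refine (measureReal_cut_le hZ hk hπ.1.1 M hM hM0 hd A _
            (hcut A hA.2.1 hA.2.2)).trans ?_
          rw [← hexp, ← Real.exp_nat_mul, Real.exp_le_exp]
          have := mul_le_mul_of_nonneg_left hw (Nat.cast_nonneg (α := ℝ) A.card)
          have e : w * A.card * (k * dMax G) / (2 * M) =
            A.card * (w * (k * dMax G) / (2 * M)) := by ring
          rw [e]
          linarith
      _ ≤ ∑ A : Finset (Fin n) with A.Nonempty, (1 / (n : ℝ) ^ 4) ^ A.card := by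
          refine Finset.sum_le_sum_of_subset_of_nonneg (fun A hA => ?_) fun _ _ _ => by positivity
          simp only [h𝒜, Finset.mem_filter] at hA ⊢
          exact ⟨hA.1, hA.2.1⟩
      _ ≤ 2 * (Fintype.card (Fin n) * (1 / (n : ℝ) ^ 4)) := by
          refine sum_pow_card_nonempty_le (Fin n) _ (by positivity) ?_
          rw [ht, div_le_one (by positivity)]
          exact one_le_pow₀ hn1
      _ = 2 / (n : ℝ) ^ 3 := by rw [ht]; ring
  have hP₂ : μ.real B₂ ≤ 1 / (n : ℝ) ^ 3 := by
    calc μ.real B₂ ≤ ∑ j : Fin n, μ.real {ω | η ≤ r ω j} := measureReal_biUnion_finset_le _ _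
      _ ≤ ∑ _j : Fin n, 1 / (n : ℝ) ^ 4 := by
          refine Finset.sum_le_sum fun j _ => ?_
          refine (measureReal_residual_ge_le hZ hk hπ M hM hd j η hη).trans ?_
          rw [← hexp, Real.exp_le_exp]
          linarith
      _ = 1 / (n : ℝ) ^ 3 := by
          simp only [Finset.sum_const, Finset.card_univ, Fintype.card_fin, nsmul_eq_mul]
          field_simp
  have hP₃ : μ.real B₃ ≤ 1 / (n : ℝ) ^ 3 := by
    refine (measureReal_residual_sq_ge_le hZ hk hπ M hM hM0 hd).trans ?_
    rw [show (-3 : ℝ) * n = -(((3 : ℕ) : ℝ) * n) by norm_num, Real.exp_neg, Real.exp_nat_mul,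
      one_div]
    gcongr
    linarith [Real.add_one_le_exp (n : ℝ)]
  have h1 : (1 : ℝ) ≤ μ.real good + (μ.real B₁ + (μ.real B₂ + μ.real B₃)) := by
    calc (1 : ℝ) = μ.real Set.univ := by simp
      _ ≤ μ.real (good ∪ (B₁ ∪ (B₂ ∪ B₃))) := measureReal_mono hcover
      _ ≤ _ := (measureReal_union_le _ _).trans (add_le_add le_rfl
          ((measureReal_union_le _ _).trans (add_le_add le_rfl (measureReal_union_le _ _))))
  have e : 4 / (n : ℝ) ^ 3 = 2 / (n : ℝ) ^ 3 + (1 / (n : ℝ) ^ 3 + 1 / (n : ℝ) ^ 3) := by ring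
  linarith

/-- Small sets expand if all entries of the stationary distribution are comparable. -/
theorem edgeExpansion_mul_card_le (G : SimpleGraph (Fin n)) (p : Fin n → Fin n → ℝ)
    (hp : ∀ i j, G.Adj i j → 0 ≤ p i j ∧ p i j ≤ 1) (π : Fin n → ℝ)
    (hst : IsStationary (canonicalMarkov G p) π) (hpos : ∀ i, 0 < π i) (m ξ : ℝ)
    (hm : 0 ≤ m) (hπm : ∀ i, m ≤ π i) (hξ : 0 ≤ ξ)
    (hφ : ξ ≤ edgeExpansion (divergenceTransition (canonicalMarkov G p) π))
    (A : Finset (Fin n)) (hA : A.Nonempty) (hAn : 2 * A.card ≤ n) :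
    ξ * m * A.card ≤ ∑ i ∈ A, ∑ j ∈ Aᶜ, edgeFlow G π p i j := by
  have hcard : A.card + Aᶜ.card = n := by
    simp
  have hApos : 0 < A.card := hA.card_pos
  have hle : A.card ≤ Aᶜ.card := by omega
  have hA' : Aᶜ.Nonempty := Finset.card_pos.1 (by omega)
  have hsum : ∀ B : Finset (Fin n), m * B.card ≤ ∑ i ∈ B, π i := fun B => by
    calc m * B.card = ∑ _i ∈ B, m := by simp [mul_comm]
      _ ≤ _ := Finset.sum_le_sum fun i _ => hπm i
  refine le_trans ?_ (edgeExpansion_mul_le G p hp π hst hpos A hA hA')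
  -- The complement has at least |A| points, so both masses are at least m |A|.
  have hmin : m * A.card ≤ min (∑ i ∈ A, π i) (∑ i ∈ Aᶜ, π i) :=
    le_min (hsum A) (le_trans (by gcongr) (hsum Aᶜ))
  rw [mul_assoc]
  exact mul_le_mul hφ hmin (by positivity) (hξ.trans hφ)

end PairwiseComparison

end

/-! ### Choice of constants and conclusion. -/

theorem mainTheorem6 (h ξ : ℝ) (hh : 0 < h) (hξ : 0 < ξ) :
    ∃ c C c₂ K : ℝ, 0 < c ∧ 0 < C ∧ 0 < c₂ ∧ 0 < K ∧
      ∀ (n : ℕ), 2 ≤ n →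
      ∀ (G : SimpleGraph (Fin n)), G.Connected →
      ∀ (p : Fin n → Fin n → ℝ), PairwiseComparison.IsComparisonModel G p →
      ∀ (π : Fin n → ℝ),
        PairwiseComparison.IsStationary (PairwiseComparison.canonicalMarkov G p) π →
        ξ ≤ PairwiseComparison.edgeExpansion
          (PairwiseComparison.divergenceTransition (PairwiseComparison.canonicalMarkov G p) π) →
        PairwiseComparison.principalRatio π ≤ h →
      ∀ (k : ℕ),
        max 1 (c * h * Real.log n / ((PairwiseComparison.dMax G : ℝ) * ξ ^ 4)) ≤ (k : ℝ) →
        Real.log n ≤ (PairwiseComparison.dMax G : ℝ) →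
      ∀ (Ω : Type*) [MeasurableSpace Ω] (μ : MeasureTheory.Measure Ω)
        [MeasureTheory.IsProbabilityMeasure μ] (Z : Fin n → Fin n → Fin k → Ω → ℝ),
        PairwiseComparison.IsComparisonData μ G p k Z →
        -- the two bounds compare deterministically
        C / ξ ^ 2 * √(h / ((k : ℝ) * (PairwiseComparison.dMax G : ℝ))) * √(n : ℝ) *
            PairwiseComparison.linftyNorm π ≤
          c₂ * PairwiseComparison.l2Norm π / √((k : ℝ) * (PairwiseComparison.dMax G : ℝ)) ∧
        -- and with high probability every stationary distribution of the empirical matrix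
        -- satisfies the sharper one
        1 - K / (n : ℝ) ^ 3 ≤ μ.real {ω | ∀ π' : Fin n → ℝ,
          PairwiseComparison.IsStationary (PairwiseComparison.empiricalMarkov G Z ω) π' →
          PairwiseComparison.l2Norm (π - π') ≤
            C / ξ ^ 2 * √(h / ((k : ℝ) * (PairwiseComparison.dMax G : ℝ))) * √(n : ℝ) *
              PairwiseComparison.linftyNorm π} := by
  have hC : 0 < 256 * h ^ 3 / √h := by positivity
  -- In c, the summand 8ξ³ serves the cuts (`hw`) and 8192h⁵ the coordinates (`hη'`, with 8192 = 2 ·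
  -- 64²). In C, 256 = 128 · 2 comes from `hfac` and `hres`, and 1/√h cancels the √h in the stated
  -- bound. The extra h in c₂ pays for M ≤ h m.
  refine ⟨8 * ξ ^ 3 + 8192 * h ^ 5, 256 * h ^ 3 / √h, 256 * h ^ 4 / ξ ^ 2, 4, by positivity, hC,
    by positivity, by norm_num, ?_⟩
  intro n hn G _ p hp π hst hφ hratio k hk _ Ω _ μ _ Z hZ
  have hne : Nonempty (Fin n) := ⟨⟨0, by omega⟩⟩
  have hn0 : (0 : ℝ) < n := by positivity
  have hlog : 0 ≤ Real.log n := Real.log_natCast_nonneg n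
  have hp' : ∀ i j, G.Adj i j → 0 ≤ p i j ∧ p i j ≤ 1 := fun i j hij =>
    ⟨(hp i j hij).1.le, (hp i j hij).2.le⟩
  have hk1 : (1 : ℝ) ≤ k := (le_max_left _ _).trans hk
  have hk0 : 0 < k := by exact_mod_cast (zero_lt_one.trans_le hk1 : (0 : ℝ) < k)
  have hd0 : (0 : ℝ) < PairwiseComparison.dMax G := by
    exact_mod_cast PairwiseComparison.dMax_pos G hne.some
  set d : ℝ := (PairwiseComparison.dMax G : ℝ) with hd
  have hkd : (8 * ξ ^ 3 + 8192 * h ^ 5) * h * Real.log n ≤ k * d * ξ ^ 4 := by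
    have := (le_max_right _ _).trans hk
    rw [div_le_iff₀ (by positivity)] at this
    linarith
  have hpos := PairwiseComparison.stationary_pos_of_edgeExpansion_pos _ π hst.1.1 (hξ.trans_le hφ)
  set M := ⨆ i, π i with hM_def
  set m := ⨅ i, π i with hm_def
  have hπM : ∀ i, π i ≤ M := fun i => le_ciSup (Set.finite_range π).bddAbove i
  have hπm : ∀ i, m ≤ π i := fun i => ciInf_le (Set.finite_range π).bddBelow i
  have hm : 0 < m := by
    obtain ⟨i, hi⟩ := exists_eq_ciInf_of_finite (f := π)
    rw [hm_def, ← hi]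
    exact hpos i
  have hmM : m ≤ M := (hπm hne.some).trans (hπM hne.some)
  have hM : 0 < M := hm.trans_le hmM
  have hMh : M ≤ h * m := by
    rwa [PairwiseComparison.principalRatio, div_le_iff₀ hm] at hratio
  have hinf : PairwiseComparison.linftyNorm π = M := by
    simp only [PairwiseComparison.linftyNorm, abs_of_pos (hpos _), hM_def]
  have hcoef : 256 * h ^ 3 / √h / ξ ^ 2 * √(h / (k * d)) * √(n : ℝ) * M =
      256 * h ^ 3 / ξ ^ 2 * (√n * M / √(k * d)) := by
    have h1 : √h ≠ 0 := (Real.sqrt_pos.2 hh).ne'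
    rw [Real.sqrt_div hh.le]
    field_simp
  rw [hinf, hcoef]
  constructor
  · have h1 : √n * m ≤ PairwiseComparison.l2Norm π := by
      refine Real.le_sqrt_of_sq_le ?_
      rw [mul_pow, Real.sq_sqrt hn0.le]
      calc (n : ℝ) * m ^ 2 = ∑ _i : Fin n, m ^ 2 := by simp
        _ ≤ _ := Finset.sum_le_sum fun i _ => pow_le_pow_left₀ hm.le (hπm i) 2
    have h2 : √n * M ≤ h * PairwiseComparison.l2Norm π := by
      calc √n * M ≤ √n * (h * m) := by gcongr
        _ = h * (√n * m) := by ring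
        _ ≤ _ := by gcongr
    calc 256 * h ^ 3 / ξ ^ 2 * (√n * M / √(k * d))
        ≤ 256 * h ^ 3 / ξ ^ 2 * (h * PairwiseComparison.l2Norm π / √(k * d)) := by gcongr
      _ = _ := by ring
  have hcut := PairwiseComparison.edgeExpansion_mul_card_le G p hp' π hst hpos m ξ hm.le hπm
    hξ.le hφ
  -- The largest residual that the perturbation bound tolerates at expansion ψ = ξ m / 4, the
  -- quarter being lost in the Chernoff step.
  set η := (ξ * m / 4) ^ 2 * m / (4 * M ^ 2) with hη_def
  have hη : 0 ≤ η := by positivity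
  have hkd0 : 0 < k * d := by positivity
  have hw : 4 * Real.log n ≤ ξ * m * (k * d) / (2 * M) := by
    rw [le_div_iff₀ (by positivity)]
    have h1 : 8 * h * Real.log n ≤ k * d * ξ := by
      refine le_of_mul_le_mul_left ?_ (pow_pos hξ 3)
      have : 0 ≤ 8192 * h ^ 5 * h * Real.log n := by positivity
      nlinarith
    calc 4 * Real.log n * (2 * M) ≤ 4 * Real.log n * (2 * (h * m)) := by gcongr
      _ = m * (8 * h * Real.log n) := by ring
      _ ≤ m * (k * d * ξ) := by gcongr
      _ = _ := by ring
  have hη' : 4 * Real.log n ≤ 2 * (k * d) * η ^ 2 / M ^ 2 := by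
    have h1 : 8192 * h ^ 6 * Real.log n ≤ k * d * ξ ^ 4 := by
      have : 0 ≤ 8 * ξ ^ 3 * h * Real.log n := by positivity
      nlinarith
    have h2 : ξ ^ 2 / (64 * h ^ 3) ≤ η / M := by
      have e : η / M = ξ ^ 2 * m ^ 3 / (64 * M ^ 3) := by
        rw [hη_def]
        field_simp
        norm_num
      rw [e, div_le_div_iff₀ (by positivity) (by positivity)]
      have h3 : M ^ 3 ≤ (h * m) ^ 3 := pow_le_pow_left₀ hM.le hMh 3
      calc ξ ^ 2 * (64 * M ^ 3) ≤ ξ ^ 2 * (64 * (h * m) ^ 3) := by gcongr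
        _ = _ := by ring
    calc 4 * Real.log n ≤ 2 * (k * d) * (ξ ^ 2 / (64 * h ^ 3)) ^ 2 := by
          rw [div_pow, mul_div_assoc', le_div_iff₀ (by positivity)]
          linarith
      _ ≤ 2 * (k * d) * (η / M) ^ 2 := by gcongr
      _ = _ := by rw [div_pow]; ring
  refine (PairwiseComparison.measureReal_good_event_ge hn hZ hk0 hst M hπM hM (ξ * m) η hη hcut
    hw hη').trans (MeasureTheory.measureReal_mono ?_)
  rintro ω ⟨hg1, hg2, hg3⟩ π' hπ'
  have hq : ∀ i j, G.Adj i j → 0 ≤ (∑ m, Z i j m ω) / (k : ℝ) ∧ (∑ m, Z i j m ω) / (k : ℝ) ≤ 1 :=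
    fun i j hij => by
    have h0 : ∀ m, 0 ≤ Z i j m ω ∧ Z i j m ω ≤ 1 := fun m => by
      rcases hZ.zero_or_one i j hij m ω with h | h <;> simp [h]
    refine ⟨div_nonneg (Finset.sum_nonneg fun m _ => (h0 m).1) (by positivity), ?_⟩
    rw [div_le_one (by positivity)]
    calc ∑ m, Z i j m ω ≤ ∑ _m : Fin k, (1 : ℝ) := Finset.sum_le_sum fun m _ => (h0 m).2
      _ = k := by simp
  have hres : PairwiseComparison.l2Norm (π ᵥ* PairwiseComparison.empiricalMarkov G Z ω - π) ≤
      2 * (√n * M / √(k * d)) := by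
    refine Real.sqrt_le_iff.2 ⟨by positivity, hg3.trans_eq ?_⟩
    rw [mul_pow, div_pow, mul_pow, Real.sq_sqrt hn0.le, Real.sq_sqrt hkd0.le]
    ring
  have hmain := PairwiseComparison.l2Norm_sub_stationary_le G _ hq π π' m M (ξ * m / 4) hm hπm hπM
    (by positivity) hst.1.2 hπ' (fun A hA => (hg1 A hA)) hg2
  refine hmain.trans ?_
  have hfac : 8 * M ^ 3 / ((ξ * m / 4) ^ 2 * m) ≤ 128 * h ^ 3 / ξ ^ 2 := by
    rw [div_le_div_iff₀ (by positivity) (by positivity)]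
    have h3 : M ^ 3 ≤ (h * m) ^ 3 := pow_le_pow_left₀ hM.le hMh 3
    calc 8 * M ^ 3 * ξ ^ 2 ≤ 8 * (h * m) ^ 3 * ξ ^ 2 := by gcongr
      _ = _ := by ring
  calc _ ≤ 128 * h ^ 3 / ξ ^ 2 * (2 * (√n * M / √(k * d))) :=
        mul_le_mul hfac hres (PairwiseComparison.l2Norm_nonneg _) (by positivity)
    _ = _ := by ring
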